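/- **Setting.** Let $d\ge 1$ and let $(X_1,Y_1),(X_2,Y_2),\dots$ be i.i.d. random variables with values in $\mathbb R^d\times\mathbb R$ such that $Y_i=m(X_i)+\varepsilon_i$. Let $g$, $f$ and $\varphi$ be the (nonnegative) Lebesgue densities of $X_i$, of $\varepsilon_i$ and of $(X_i,Y_i)$. Assume: - the support $\mathcal X$ of $X_1$ is compact, and $\mathcal X_0$ is a closed set with nonempty interior which is contained in the interior of $\mathcal X$; - $g>0$ on $\mathcal X_0$, and $g$ and $m$ have continuous second order partial derivatives over $\mathcal X$; - the errors are centered, have finite sixth moments, and $\varepsilon_i$ is independent of $X_i$; hence the conditional density $f(\cdot|x)$ of $\varepsilon_i$ given $X_i=x$ is $f$; - $f$ is twice continuously differentiable on $\mathbb R$ and, for $p,k\in\{0,1,2\}$, the $k$-th derivative of $e\mapsto e^pf(e)$ is bounded on $\mathbb R$; - $\varphi$ has bounded continuous second order partial derivatives over $\mathbb R^d\times\mathbb R$; - $K_0:\mathbb R^d\to\mathbb R$ is continuous, even, with support contained in $[-1/2,1/2]^d$ and $\int K_0(z)\,dz=1$; $K_1:\mathbb R\to\mathbb R$ is three times continuously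 differentiable with compact support, $\int K_1(v)\,dv=1$ and $\int vK_1(v)\,dv=0$; - the bandwidths $b_0=b_0(n)$, $h_0=h_0(n)$, $h_1=h_1(n)$ are positive and tend to $0$ as $n\to\infty$, and, with $d^*=\max(d+2,2d)$, $$\frac{nb_0^{d^*}}{\ln n}\to\infty,\quad \frac{\ln(1/b_0)}{\ln\ln n}\to\infty,\quad \frac{nh_0^{2d}}{\ln n}\to\infty,\quad \frac{\ln(1/h_0)}{\ln\ln n}\to\infty,$$ $$(\mathbf A_0)\qquad nh_0^dh_1\to\infty,\qquad \frac{nh_0^d}{h_1}\Big(b_0^4+\frac{\ln n}{nb_0^d}\Big)\to0 .$$ Define the Nadaraya–Watson estimator and the naive conditional estimator $$\hat m_n(x)=\frac{\sum_{j=1}^nY_jK_0\big(\frac{X_j-x}{b_0}\big)}{\sum_{j=1}^nK_0\big(\frac{X_j-x}{b_0}\big)},\qquad \tilde f_n(\epsilon|x)=\frac{\frac1{nh_0^dh_1}\sum_{i=1}^nK_0\big(\frac{X_i-x}{h_0}\big)K_1\big(\frac{Y_i-\hat m_n(x)-\epsilon}{h_1}\big)}{\frac1{nh_0^d}\sum_{i=1}^nK_0\big(\frac{X_i-x}{h_0}\big)},$$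 and $$\mu_1(x,\epsilon)=\int z\,\frac{\partial^2\varphi}{\partial x^2}(x,m(x)+\epsilon)\,z^\top K_0(z)\,dz,\qquad \mu_2(x,\epsilon)=\frac{\partial^2\varphi}{\partial y^2}(x,m(x)+\epsilon)\int v^2K_1(v)\,dv,$$ where $\partial^2\varphi/\partial x^2$ is the Hessian matrix of $\varphi(x,y)$ in $x$ with $y$ fixed. **Proposition 3.1.** Let $x\in\mathcal X_0$ and $\epsilon\in\mathbb R$. (i) There is a deterministic sequence $\bar f_n(\epsilon|x)$ with $$\bar f_n(\epsilon|x)=f(\epsilon|x)+\frac{h_0^2\mu_1(x,\epsilon)}{2g(x)}+\frac{h_1^2\mu_2(x,\epsilon)}{2g(x)}+o(h_0^2+h_1^2)\qquad(n\to\infty)$$ such that $$\sqrt{nh_0^dh_1}\,\big(\tilde f_n(\epsilon|x)-\bar f_n(\epsilon|x)\big)\xrightarrow{d}\mathcal N\Big(0,\frac{f(\epsilon|x)}{g(x)}\iint K_0^2(z)K_1^2(v)\,dz\,dv\Big).$$ (ii) For $n\ge1$ and $s_0,s_1>0$ consider the first order terms of the asymptotic mean square expansion, $$\mathrm{AMSE}_n(s_0,s_1)=\Big[\frac{s_0^2\mu_1(x,\epsilon)}{2g(x)}+\frac{s_1^2\mu_2(x,\epsilon)}{2g(x)}\Big]^2+\frac{f(\epsilon|x)\int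 K_0^2(z)\,dz\int K_1^2(v)\,dv}{n\,s_0^d\,s_1\,g(x)} .$$ If $f(\epsilon|x)>0$ and $\mu_1(x,\epsilon)\mu_2(x,\epsilon)>0$, then there are constants $c_0,c_1,C>0$, not depending on $n$, such that for every $n\ge1$ the unique minimizer of $\mathrm{AMSE}_n$ over $(0,\infty)^2$ is $(c_0n^{-1/(d+5)},\,c_1n^{-1/(d+5)})$, and at this minimizer $\sqrt{\mathrm{AMSE}_n}=C\,n^{-2/(d+5)}$. -/

import Mathlib

open MeasureTheory ProbabilityTheory Filter Topology Asymptotics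

namespace NaiveResidualDensity

/-- The covariate space `ℝ^d` with its Euclidean structure and Lebesgue measure. -/
abbrev Cov (d : ℕ) : Type := EuclideanSpace ℝ (Fin d)

/-- The regression model `Y_i = m(X_i) + ε_i`: the pairs `(X_i, Y_i)` are i.i.d., the errors are
centered, have a finite sixth moment and are independent of the covariates. The functions `g`, `f`
and `φ` are the Lebesgue densities of `X_i`, of `ε_i` and of `(X_i, Y_i)`. -/
structure RegressionModel {Ω : Type*} [MeasurableSpace Ω] (μ : Measure Ω) {d : ℕ}
    (X : ℕ → Ω → Cov d) (Y ε : ℕ → Ω → ℝ) (m g : Cov d → ℝ) (f : ℝ → ℝ)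
    (φ : Cov d × ℝ → ℝ) : Prop where
  measurable_X : ∀ i, Measurable (X i)
  measurable_Y : ∀ i, Measurable (Y i)
  measurable_m : Measurable m
  model : ∀ i ω, Y i ω = m (X i ω) + ε i ω
  indep_pairs : iIndepFun (fun i ω => (X i ω, Y i ω)) μ
  ident_pairs : ∀ i, IdentDistrib (fun ω => (X i ω, Y i ω)) (fun ω => (X 0 ω, Y 0 ω)) μ μ
  indep_error : ∀ i, IndepFun (X i) (ε i) μ
  moment_error : ∀ i, MemLp (ε i) 6 μ
  centered_error : ∀ i, ∫ ω, ε i ω ∂μ = 0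
  measurable_g : Measurable g
  nonneg_g : ∀ x, 0 ≤ g x
  law_X : ∀ i, μ.map (X i) = volume.withDensity (fun x => ENNReal.ofReal (g x))
  measurable_f : Measurable f
  nonneg_f : ∀ e, 0 ≤ f e
  law_error : ∀ i, μ.map (ε i) = volume.withDensity (fun e => ENNReal.ofReal (f e))
  measurable_φ : Measurable φ
  nonneg_φ : ∀ p, 0 ≤ φ p
  law_pair : ∀ i, μ.map (fun ω => (X i ω, Y i ω)) =
    volume.withDensity (fun p => ENNReal.ofReal (φ p))

/-- Regularity of the model. `S` is the support of the covariate and `S₀` the inner subset. -/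
structure Regularity {d : ℕ} (S S₀ : Set (Cov d)) (m g : Cov d → ℝ) (f : ℝ → ℝ)
    (φ : Cov d × ℝ → ℝ) : Prop where
  compact_S : IsCompact S
  closed_S₀ : IsClosed S₀
  inner_S₀ : S₀ ⊆ interior S
  interior_S₀ : (interior S₀).Nonempty
  pos_g : ∀ x ∈ S₀, 0 < g x
  smooth_g : ContDiffOn ℝ 2 g S
  smooth_m : ContDiffOn ℝ 2 m S
  smooth_f : ContDiff ℝ 2 f
  bounded_f : ∀ p k : ℕ, p ≤ 2 → k ≤ 2 → ∃ C : ℝ, ∀ e : ℝ,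
    |iteratedDeriv k (fun t : ℝ => t ^ p * f t) e| ≤ C
  smooth_φ : ContDiff ℝ 2 φ
  bounded_φ : ∃ C : ℝ, ∀ p, ‖iteratedFDeriv ℝ 2 φ p‖ ≤ C

/-- Conditions on the kernels. -/
structure KernelConditions {d : ℕ} (K₀ : Cov d → ℝ) (K₁ : ℝ → ℝ) : Prop where
  even_K₀ : ∀ z, K₀ (-z) = K₀ z
  continuous_K₀ : Continuous K₀
  support_K₀ : ∀ z, K₀ z ≠ 0 → ∀ j, |z j| ≤ 1 / 2
  integral_K₀ : ∫ z, K₀ z = 1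
  compact_K₁ : HasCompactSupport K₁
  smooth_K₁ : ContDiff ℝ 3 K₁
  integral_K₁ : ∫ v, K₁ v = 1
  first_moment_K₁ : ∫ v, v * K₁ v = 0

/-- Conditions on the bandwidths `b₀`, `h₀`, `h₁`. -/
structure BandwidthConditions (d : ℕ) (b₀ h₀ h₁ : ℕ → ℝ) : Prop where
  pos_b₀ : ∀ n, 0 < b₀ n
  pos_h₀ : ∀ n, 0 < h₀ n
  pos_h₁ : ∀ n, 0 < h₁ n
  tendsto_b₀ : Tendsto b₀ atTop (𝓝 0)
  tendsto_h₀ : Tendsto h₀ atTop (𝓝 0)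
  tendsto_h₁ : Tendsto h₁ atTop (𝓝 0)
  large_b₀ : Tendsto (fun n : ℕ => (n : ℝ) * b₀ n ^ max (d + 2) (2 * d) / Real.log n) atTop atTop
  log_b₀ : Tendsto (fun n : ℕ => Real.log (1 / b₀ n) / Real.log (Real.log n)) atTop atTop
  large_h₀ : Tendsto (fun n : ℕ => (n : ℝ) * h₀ n ^ (2 * d) / Real.log n) atTop atTop
  log_h₀ : Tendsto (fun n : ℕ => Real.log (1 / h₀ n) / Real.log (Real.log n)) atTop atTop
  large_h₀_h₁ : Tendsto (fun n : ℕ => (n : ℝ) * h₀ n ^ d * h₁ n) atTop atTop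
  small_pilot : Tendsto (fun n : ℕ => ((n : ℝ) * h₀ n ^ d / h₁ n) *
    (b₀ n ^ 4 + Real.log n / ((n : ℝ) * b₀ n ^ d))) atTop (𝓝 0)

/-- The Nadaraya–Watson estimator of `m x` with bandwidth `b`, from the first `n` observations
`xs i`, `ys i`, `i < n`. -/
noncomputable def nadarayaWatson {d : ℕ} (K₀ : Cov d → ℝ) (b : ℝ) (n : ℕ)
    (xs : ℕ → Cov d) (ys : ℕ → ℝ) (x : Cov d) : ℝ :=
  (∑ j ∈ Finset.range n, ys j * K₀ (b⁻¹ • (xs j - x))) /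
    ∑ j ∈ Finset.range n, K₀ (b⁻¹ • (xs j - x))

/-- The naive conditional kernel estimator `f̃_n(e | x)`. -/
noncomputable def naiveEstimator {d : ℕ} (K₀ : Cov d → ℝ) (K₁ : ℝ → ℝ) (b₀ h₀ h₁ : ℝ) (n : ℕ)
    (xs : ℕ → Cov d) (ys : ℕ → ℝ) (e : ℝ) (x : Cov d) : ℝ :=
  (1 / ((n : ℝ) * h₀ ^ d * h₁) * ∑ i ∈ Finset.range n,
      K₀ (h₀⁻¹ • (xs i - x)) * K₁ ((ys i - nadarayaWatson K₀ b₀ n xs ys x - e) / h₁)) /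
    (1 / ((n : ℝ) * h₀ ^ d) * ∑ i ∈ Finset.range n, K₀ (h₀⁻¹ • (xs i - x)))

/-- `μ₁(x, e) = ∫ z ∂²φ/∂x² (x, m(x) + e) zᵀ K₀(z) dz`; the Hessian is that of
`u ↦ φ(u, y)` at `u = x`, with `y = m(x) + e` held fixed. -/
noncomputable def mu1 {d : ℕ} (K₀ : Cov d → ℝ) (m : Cov d → ℝ) (φ : Cov d × ℝ → ℝ)
    (x : Cov d) (e : ℝ) : ℝ :=
  ∫ z, iteratedFDeriv ℝ 2 (fun u => φ (u, m x + e)) x ![z, z] * K₀ z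

/-- `μ₂(x, e) = ∂²φ/∂y² (x, m(x) + e) ∫ v² K₁(v) dv`. -/
noncomputable def mu2 {d : ℕ} (K₁ : ℝ → ℝ) (m : Cov d → ℝ) (φ : Cov d × ℝ → ℝ)
    (x : Cov d) (e : ℝ) : ℝ :=
  iteratedDeriv 2 (fun t => φ (x, t)) (m x + e) * ∫ v, v ^ 2 * K₁ v

/-- The leading bias terms `h₀² μ₁ / (2 g(x)) + h₁² μ₂ / (2 g(x))`. -/
noncomputable def leadingBias {d : ℕ} (K₀ : Cov d → ℝ) (K₁ : ℝ → ℝ) (m g : Cov d → ℝ)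
    (φ : Cov d × ℝ → ℝ) (x : Cov d) (e h₀ h₁ : ℝ) : ℝ :=
  h₀ ^ 2 * mu1 K₀ m φ x e / (2 * g x) + h₁ ^ 2 * mu2 K₁ m φ x e / (2 * g x)

/-- The asymptotic variance `f(e | x) / g(x) * ∫∫ K₀²(z) K₁²(v) dz dv`. As the error is
independent of the covariate, its conditional density `f(· | x)` is `f`. -/
noncomputable def asympVar {d : ℕ} (K₀ : Cov d → ℝ) (K₁ : ℝ → ℝ) (g : Cov d → ℝ)
    (f : ℝ → ℝ) (x : Cov d) (e : ℝ) : ℝ :=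
  f e / g x * ∫ z, ∫ v, K₀ z ^ 2 * K₁ v ^ 2

/-- The first order terms of the asymptotic mean square expansion of the naive estimator, as a
function of the sample size and of the bandwidths `h₀`, `h₁`. -/
noncomputable def amse {d : ℕ} (K₀ : Cov d → ℝ) (K₁ : ℝ → ℝ) (m g : Cov d → ℝ) (f : ℝ → ℝ)
    (φ : Cov d × ℝ → ℝ) (x : Cov d) (e : ℝ) (n : ℕ) (h₀ h₁ : ℝ) : ℝ :=
  leadingBias K₀ K₁ m g φ x e h₀ h₁ ^ 2 +
    f e * (∫ z, K₀ z ^ 2) * (∫ v, K₁ v ^ 2) / ((n : ℝ) * h₀ ^ d * h₁ * g x)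

end NaiveResidualDensity

namespace NaiveResidualDensity

/-! Write `N = n h₀^d h₁`, let `a` be the joint density `φ` smoothed at `(x, m x + e)` by the
product kernel with bandwidths `(h₀, h₁)`, and let `G` be the kernel estimator of `g x` in the
denominator of the naive estimator. The deterministic centering is `a / g x`, with the exact value
`g x` below and not the mean of `G`. Let `S` be the kernel sum built on the pilot estimate of `m x`,
and `A` the same sum built on the true `m x`. Where `G ≠ 0`, `√N (S / (N G) - a / g x) = [(A - N a)
/ √N + (S - A) / √N - (a / g x) √N (G - g x)] / G`. The first term is asymptotically Gaussian, the
next two vanish in probability and `G` tends to `g x`, so Slutsky's lemma gives the limit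
(`RegressionModel.tendstoInDistribution_naiveEstimator`).

The Gaussian term is a row sum of i.i.d. bounded variables of size `O(1/√N)`, handled by
characteristic functions (`tendstoInDistribution_sum_of_bounded`). The plug-in term is at most `√N /
h₁ * |m̂ - m x|` times a sum bounded in `L¹`, because `K₁` is Lipschitz with compact support. Since
everything happens at the single point `x`, a pointwise `L²` bound of order `b₀⁴ + 1 / (n b₀^d)` for
the numerator of the pilot error suffices, together with consistency of its denominator; no uniform
rate enters, and the bandwidth condition is exactly what makes the scaled error vanish. For the
denominator term, the same condition forces `h₀ ≤ b₀` eventually, hence `N h₀⁴ → 0`: the `h₀²` bias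
of `G` is invisible at scale `√N`, which is why `g x` can replace the mean of `G`
(`BandwidthConditions.tendsto_undersmoothing`).

The expansion of the centering is a second order Taylor expansion of `φ` under the kernel integral,
where symmetry and the moment conditions remove the linear and mixed terms. Independence of error
and covariate gives `φ (x, m x + e) = g x * f e`, which identifies the leading term and the
variance.

For the bandwidths, logarithmic coordinates turn the AMSE into a positive combination of
exponentials of linear forms, so a critical point is the only minimizer. Homogeneity under `(s, t) ↦
(ρ s, ρ t)` with `n ρ^(d+5) = 1` reduces every `n` to `n = 1`. -/

theorem tendsto_const_add_nhds_zero {V : Type*} [NormedAddCommGroup V] (p : V) :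
    Tendsto (fun w : V => p + w) (𝓝 0) (𝓝 p) := by
  have h := (by fun_prop : Continuous fun w : V => p + w).tendsto 0
  simpa using h

/-! ### Second order Taylor expansion with Peano remainder -/

section Taylor

variable {V : Type*} [NormedAddCommGroup V] [NormedSpace ℝ V]

/-- The second order Taylor polynomial of `F` at `p`, as a function of the increment. -/
noncomputable def taylorTwo (F : V → ℝ) (p w : V) : ℝ :=
  F p + fderiv ℝ F p w + 1 / 2 * fderiv ℝ (fderiv ℝ F) p w w

theorem continuous_taylorTwo (F : V → ℝ) (p : V) : Continuous (taylorTwo F p) := by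
  unfold taylorTwo
  fun_prop

/-- The gradient of the remainder at increment `u` is the first order Taylor remainder of `fderiv ℝ
F`, which is `o(‖u‖)`. The mean value inequality on the ball of radius `‖w‖` gains the second factor
`‖w‖`. Symmetry of the second derivative makes the gradient of the quadratic part equal to `D2 u`.
-/
theorem sub_taylorTwo_isLittleO {F : V → ℝ} {p : V} (hF : ContDiffAt ℝ 2 F p) :
    (fun w => F (p + w) - taylorTwo F p w) =o[𝓝 0] fun w => ‖w‖ ^ 2 := by
  set D := fderiv ℝ F p
  set D2 := fderiv ℝ (fderiv ℝ F) p
  have hsymm : ∀ v w, D2 v w = D2 w v := (hF.isSymmSndFDerivAt (by simp)).eq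
  have hdiff : ∀ᶠ w in 𝓝 (0 : V), HasFDerivAt F (fderiv ℝ F (p + w)) (p + w) := by
    have h1 : ∀ᶠ q in 𝓝 p, HasFDerivAt F (fderiv ℝ F q) q :=
      (hF.eventually (by simp)).mono fun q hq => (hq.differentiableAt (by simp)).hasFDerivAt
    have h2 : Tendsto (fun w : V => p + w) (𝓝 0) (𝓝 p) := tendsto_const_add_nhds_zero p
    exact h2.eventually h1
  have hD2 : HasFDerivAt (fderiv ℝ F) D2 p :=
    ((hF.fderiv_right (m := 1) (by norm_num)).differentiableAt (by simp)).hasFDerivAt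
  rw [hasFDerivAt_iff_isLittleO_nhds_zero] at hD2
  refine isLittleO_iff.2 fun c hc => ?_
  have h3 := hdiff.and (isLittleO_iff.1 hD2 hc)
  obtain ⟨r, hr, hball⟩ := Metric.eventually_nhds_iff_ball.1 h3
  filter_upwards [Metric.ball_mem_nhds (0 : V) hr] with w hw
  have hsub : ∀ u ∈ Metric.closedBall (0 : V) ‖w‖, u ∈ Metric.ball (0 : V) r := fun u hu => by
    simp only [Metric.mem_ball, Metric.mem_closedBall, dist_zero_right] at *
    linarith
  have key := (convex_closedBall (0 : V) ‖w‖).norm_image_sub_le_of_norm_hasFDerivWithin_le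
    (𝕜 := ℝ) (f := fun u => F (p + u) - taylorTwo F p u)
    (f' := fun u => fderiv ℝ F (p + u) - D - D2 u) (C := c * ‖w‖) (x := 0) (y := w)
    (fun u hu => ?_) (fun u hu => ?_) (by simp) (by simp)
  · simp only [taylorTwo, add_zero, map_zero, sub_zero, mul_zero, sub_self] at key
    rw [Real.norm_of_nonneg (by positivity : 0 ≤ ‖w‖ ^ 2), pow_two, ← mul_assoc]
    simpa [taylorTwo] using key
  · have hu1 := (hball u (hsub u hu)).1
    have e1 : HasFDerivAt (fun u => F (p + u)) (fderiv ℝ F (p + u)) u := by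
      have := hu1.comp u ((hasFDerivAt_id u).const_add p)
      exact this
    have e2 : HasFDerivAt (taylorTwo F p) (D + D2 u) u := by
      have ha : HasFDerivAt (fun u => D2 u u) (D2.precompR V u (ContinuousLinearMap.id ℝ V) +
          D2.precompL V (ContinuousLinearMap.id ℝ V) u) u :=
        D2.hasFDerivAt_of_bilinear (hasFDerivAt_id u) (hasFDerivAt_id u)
      have hb := ((D.hasFDerivAt (x := u)).const_add (F p)).add (ha.const_mul (1 / 2))
      refine hb.congr_fderiv ?_
      ext v
      simp [hsymm v u]
      ring
    have e3 := e1.sub e2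
    rw [← sub_sub] at e3
    exact e3.hasFDerivWithinAt
  · have hu2 := (hball u (hsub u hu)).2
    refine hu2.trans ?_
    gcongr
    simpa using hu

end Taylor

/-! ### Smoothing by a kernel with a shrinking window -/

section KernelIntegrals

variable {V : Type*} [NormedAddCommGroup V] {L : V → ℝ} {F : V → ℝ} {A : ℕ → V → V}
  {η : ℕ → ℝ} {p : V} {R : ℝ}

/-- The maps `A n` stand for rescalings of the window. Only `‖A n w‖ ≤ η n * ‖w‖` is used, so the
isotropic scaling in the covariate and the anisotropic one in the pair, with `η` the larger
bandwidth, are treated together. -/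
theorem eventually_forall_norm_le_of_scaling (hA : ∀ n w, ‖A n w‖ ≤ η n * ‖w‖)
    (hη : Tendsto η atTop (𝓝 0)) (R : ℝ) {P : V → Prop} (hP : ∀ᶠ w in 𝓝 (0 : V), P w) :
    ∀ᶠ n in atTop, ∀ w, ‖w‖ ≤ R → P (A n w) := by
  obtain ⟨r, hr, hball⟩ := Metric.eventually_nhds_iff_ball.1 hP
  have h1 : Tendsto (fun n => |η n| * |R|) atTop (𝓝 0) := by
    simpa using hη.abs.mul_const |R|
  filter_upwards [h1.eventually_lt_const hr] with n hn w hw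
  refine hball _ ?_
  rw [Metric.mem_ball, dist_zero_right]
  calc ‖A n w‖ ≤ η n * ‖w‖ := hA n w
    _ ≤ |η n| * |R| := by
      gcongr
      · exact le_abs_self _
      · exact hw.trans (le_abs_self _)
    _ < r := hn

theorem eventually_abs_kernel_mul_le (hL : ∀ w, L w ≠ 0 → ‖w‖ ≤ R)
    (hFp : ContinuousAt F p)
    (hA : ∀ n w, ‖A n w‖ ≤ η n * ‖w‖) (hη : Tendsto η atTop (𝓝 0)) :
    ∀ᶠ n in atTop, ∀ w, ‖L w * F (p + A n w)‖ ≤ ‖L w‖ * (‖F p‖ + 1) := by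
  have h2 : Tendsto (fun w : V => p + w) (𝓝 0) (𝓝 p) := tendsto_const_add_nhds_zero p
  have h1 : ∀ᶠ w in 𝓝 (0 : V), ‖F (p + w)‖ < ‖F p‖ + 1 :=
    (hFp.norm.tendsto.comp h2).eventually_lt_const (lt_add_one _)
  filter_upwards [eventually_forall_norm_le_of_scaling hA hη R h1] with n hn w
  rw [norm_mul]
  by_cases hw : L w = 0
  · simp [hw]
  · gcongr
    exact (hn w (hL w hw)).le

variable [MeasurableSpace V] {ν : Measure V}

theorem eventually_integrable_kernel_mul (hLi : Integrable L ν) (hL : ∀ w, L w ≠ 0 → ‖w‖ ≤ R)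
    (hF : Measurable F) (hFp : ContinuousAt F p) (hAm : ∀ n, Measurable fun w => p + A n w)
    (hA : ∀ n w, ‖A n w‖ ≤ η n * ‖w‖) (hη : Tendsto η atTop (𝓝 0)) :
    ∀ᶠ n in atTop, Integrable (fun w => L w * F (p + A n w)) ν := by
  filter_upwards [eventually_abs_kernel_mul_le hL hFp hA hη] with n hn
  refine (hLi.norm.mul_const (‖F p‖ + 1)).mono'
    (hLi.aestronglyMeasurable.mul (hF.comp (hAm n)).aestronglyMeasurable) (ae_of_all _ hn)

/-- Smoothing with a kernel whose window shrinks recovers the value at a continuity point. -/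
theorem tendsto_integral_kernel_mul (hLi : Integrable L ν) (hL : ∀ w, L w ≠ 0 → ‖w‖ ≤ R)
    (hF : Measurable F) (hFp : ContinuousAt F p) (hAm : ∀ n, Measurable fun w => p + A n w)
    (hA : ∀ n w, ‖A n w‖ ≤ η n * ‖w‖) (hη : Tendsto η atTop (𝓝 0)) :
    Tendsto (fun n => ∫ w, L w * F (p + A n w) ∂ν) atTop (𝓝 ((∫ w, L w ∂ν) * F p)) := by
  rw [← integral_mul_const]
  refine tendsto_integral_filter_of_dominated_convergence (fun w => ‖L w‖ * (‖F p‖ + 1))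
    (Eventually.of_forall fun n =>
      hLi.aestronglyMeasurable.mul (hF.comp (hAm n)).aestronglyMeasurable) ?_
    (hLi.norm.mul_const _) (ae_of_all _ fun w => ?_)
  · filter_upwards [eventually_abs_kernel_mul_le hL hFp hA hη] with n hn
    exact ae_of_all _ hn
  · refine Tendsto.const_mul _ (hFp.tendsto.comp ?_)
    have h0 : Tendsto (fun n => A n w) atTop (𝓝 0) :=
      squeeze_zero_norm (fun n => hA n w) (by simpa using hη.mul_const ‖w‖)
    simpa using h0.const_add p

variable [BorelSpace V] [NormedSpace ℝ V]

/-- Smoothing a twice differentiable function, up to terms of second order. -/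
theorem integral_kernel_mul_sub_taylorTwo_isLittleO (hLi : Integrable L ν)
    (hL : ∀ w, L w ≠ 0 → ‖w‖ ≤ R) (hF : Measurable F) (hFp : ContDiffAt ℝ 2 F p)
    (hAm : ∀ n, Measurable (A n)) (hAm' : ∀ n, Measurable fun w => p + A n w)
    (hA : ∀ n w, ‖A n w‖ ≤ η n * ‖w‖) (hη : Tendsto η atTop (𝓝 0)) :
    (fun n => (∫ w, L w * F (p + A n w) ∂ν) - ∫ w, L w * taylorTwo F p (A n w) ∂ν)
      =o[atTop] fun n => η n ^ 2 := by
  have hT : ∀ᶠ n in atTop, Integrable (fun w => L w * taylorTwo F p (A n w)) ν := by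
    have h := eventually_integrable_kernel_mul (p := 0) hLi hL
      (continuous_taylorTwo F p).measurable (continuous_taylorTwo F p).continuousAt
      (by simpa using hAm) hA hη
    simpa using h
  refine isLittleO_iff.2 fun c hc => ?_
  set I := ∫ w, ‖L w‖ ∂ν
  have hI : 0 ≤ I := integral_nonneg fun w => norm_nonneg _
  -- The remainder will be multiplied by at most `I * R ^ 2`; the added `1` avoids a zero
  -- denominator.
  have hc' : 0 < c / (I * R ^ 2 + 1) := by positivity
  filter_upwards [hT, eventually_integrable_kernel_mul hLi hL hF hFp.continuousAt hAm' hA hη,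
    eventually_forall_norm_le_of_scaling hA hη R (isLittleO_iff.1 (sub_taylorTwo_isLittleO hFp) hc')]
    with n h1 h2 h3
  rw [← integral_sub h2 h1]
  have hb : ∀ w, ‖L w * F (p + A n w) - L w * taylorTwo F p (A n w)‖ ≤
      ‖L w‖ * (c / (I * R ^ 2 + 1) * (R ^ 2 * η n ^ 2)) := fun w => by
    rw [← mul_sub, norm_mul]
    by_cases hw : L w = 0
    · simp [hw]
    · have hwR := hL w hw
      gcongr
      refine (h3 w hwR).trans ?_
      rw [norm_pow, norm_norm]
      gcongr
      calc ‖A n w‖ ^ 2 ≤ (η n * ‖w‖) ^ 2 := by gcongr; exact hA n w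
        _ = ‖w‖ ^ 2 * η n ^ 2 := by ring
        _ ≤ R ^ 2 * η n ^ 2 := by gcongr
  calc _ ≤ ∫ w, ‖L w‖ * (c / (I * R ^ 2 + 1) * (R ^ 2 * η n ^ 2)) ∂ν :=
        norm_integral_le_of_norm_le (hLi.norm.mul_const _) (ae_of_all _ hb)
    _ = c * (I * R ^ 2 / (I * R ^ 2 + 1)) * η n ^ 2 := by
        rw [integral_mul_const]; ring
    _ ≤ c * 1 * η n ^ 2 := by
        gcongr
        rw [div_le_one (by positivity)]
        linarith
    _ = c * ‖η n ^ 2‖ := by rw [Real.norm_of_nonneg (by positivity), mul_one]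

end KernelIntegrals

/-! ### Rescaling Lebesgue integrals -/

section ChangeOfVariables

variable {d : ℕ}

theorem integral_comp_rescale {h : ℝ} (hh : 0 < h) (x : Cov d) (L q : Cov d → ℝ) :
    ∫ u, L (h⁻¹ • (u - x)) * q u = h ^ d * ∫ z, L z * q (x + h • z) := by
  rw [← integral_add_left_eq_self (fun u => L (h⁻¹ • (u - x)) * q u) x]
  simp only [add_sub_cancel_left]
  have := Measure.integral_comp_smul (volume : Measure (Cov d))
    (fun z => L (h⁻¹ • z) * q (x + z)) h
  simp only [inv_smul_smul₀ hh.ne', finrank_euclideanSpace, Fintype.card_fin, smul_eq_mul] at this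
  rw [this, abs_of_pos (by positivity), ← mul_assoc, mul_inv_cancel₀ (by positivity), one_mul]

theorem map_rescale_prod {h k : ℝ} (hh : 0 < h) (hk : 0 < k) (x : Cov d) (y : ℝ) :
    (volume : Measure (Cov d × ℝ)).map (fun w => (x + h • w.1, y + k * w.2)) =
      ENNReal.ofReal ((h ^ d * k)⁻¹) • volume := by
  have h1 : (volume : Measure (Cov d)).map (fun z => x + h • z) =
      ENNReal.ofReal ((h ^ d)⁻¹) • volume := by
    rw [show (fun z : Cov d => x + h • z) = (fun z => x + z) ∘ (h • ·) from rfl,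
      ← Measure.map_map (measurable_const_add x) (measurable_const_smul h),
      Measure.map_addHaar_smul _ hh.ne', Measure.map_smul, map_add_left_eq_self]
    simp [abs_of_pos hh]
  have h2 : (volume : Measure ℝ).map (fun z => y + k * z) = ENNReal.ofReal k⁻¹ • volume := by
    rw [show (fun z : ℝ => y + k * z) = (fun z => y + z) ∘ (k • ·) from rfl,
      ← Measure.map_map (measurable_const_add y) (measurable_const_smul k),
      Measure.map_addHaar_smul _ hk.ne', Measure.map_smul, map_add_left_eq_self]
    simp [abs_of_pos hk]
  have h3 := Measure.map_prod_map (volume : Measure (Cov d)) (volume : Measure ℝ)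
    (f := fun z => x + h • z) (g := fun z => y + k * z) (by fun_prop) (by fun_prop)
  rw [h1, h2, Measure.prod_smul_left, Measure.prod_smul_right, smul_smul,
    ← ENNReal.ofReal_mul (by positivity), ← mul_inv] at h3
  exact h3.symm

theorem integral_comp_rescale_prod {h k : ℝ} (hh : 0 < h) (hk : 0 < k) (x : Cov d) (y : ℝ)
    {L q : Cov d × ℝ → ℝ} (hL : Measurable L) (hq : Measurable q) :
    ∫ p : Cov d × ℝ, L (h⁻¹ • (p.1 - x), (p.2 - y) / k) * q p =
      h ^ d * k * ∫ w, L w * q ((x, y) + (h • w.1, k * w.2)) := by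
  have hm : Measurable fun p : Cov d × ℝ => L (h⁻¹ • (p.1 - x), (p.2 - y) / k) * q p := by
    refine (hL.comp ?_).mul hq
    fun_prop
  have h1 := integral_map (μ := (volume : Measure (Cov d × ℝ)))
    (φ := fun w => (x + h • w.1, y + k * w.2)) (by fun_prop) hm.aestronglyMeasurable
  rw [map_rescale_prod hh hk, integral_smul_measure, ENNReal.toReal_ofReal (by positivity),
    smul_eq_mul] at h1
  simp only [add_sub_cancel_left, inv_smul_smul₀ hh.ne', mul_div_cancel_left₀ _ hk.ne'] at h1
  have hne : h ^ d * k ≠ 0 := by positivity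
  simp only [Prod.mk_add_mk]
  rw [← h1, mul_inv_cancel_left₀ hne]

end ChangeOfVariables

/-! ### Convergence in probability to constants -/

section ConvergenceInMeasure

variable {Ω : Type*} [MeasurableSpace Ω] {μ : Measure Ω}

theorem tendstoInMeasure_const_iff {E : Type*} [PseudoMetricSpace E] {U : ℕ → Ω → E} {c : E} :
    TendstoInMeasure μ U atTop (fun _ => c) ↔
      ∀ s ∈ 𝓝 c, Tendsto (fun n => μ {ω | U n ω ∉ s}) atTop (𝓝 0) := by
  rw [tendstoInMeasure_iff_dist]
  refine ⟨fun h s hs => ?_, fun h ε hε => ?_⟩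
  · obtain ⟨ε, hε, hball⟩ := Metric.mem_nhds_iff.1 hs
    refine tendsto_of_tendsto_of_tendsto_of_le_of_le tendsto_const_nhds (h ε hε)
      (fun n => zero_le) fun n => measure_mono fun ω hω => ?_
    by_contra hlt
    exact hω (hball (Metric.mem_ball.2 (not_le.1 hlt)))
  · refine (h _ (Metric.ball_mem_nhds c hε)).congr fun n => ?_
    simp [Metric.mem_ball]

theorem tendsto_measure_zero_of_subset_union {s t u : ℕ → Set Ω}
    (hst : ∀ᶠ n in atTop, s n ⊆ t n ∪ u n) (ht : Tendsto (fun n => μ (t n)) atTop (𝓝 0))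
    (hu : Tendsto (fun n => μ (u n)) atTop (𝓝 0)) :
    Tendsto (fun n => μ (s n)) atTop (𝓝 0) := by
  have h := ht.add hu
  rw [add_zero] at h
  refine tendsto_of_tendsto_of_tendsto_of_le_of_le' tendsto_const_nhds h
    (Eventually.of_forall fun n => zero_le) ?_
  filter_upwards [hst] with n hn
  exact (measure_mono hn).trans (measure_union_le _ _)

theorem tendstoInMeasure_continuousAt_comp {E E' : Type*} [PseudoMetricSpace E]
    [PseudoMetricSpace E'] {U : ℕ → Ω → E} {c : E} {h : E → E'} (hh : ContinuousAt h c)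
    (hU : TendstoInMeasure μ U atTop (fun _ => c)) :
    TendstoInMeasure μ (fun n ω => h (U n ω)) atTop (fun _ => h c) := by
  rw [tendstoInMeasure_const_iff] at *
  exact fun s hs => hU _ (hh hs)

theorem tendstoInMeasure_prodMk {E E' : Type*} [PseudoMetricSpace E] [PseudoMetricSpace E']
    {U : ℕ → Ω → E} {U' : ℕ → Ω → E'} {c : E} {c' : E'}
    (hU : TendstoInMeasure μ U atTop (fun _ => c))
    (hU' : TendstoInMeasure μ U' atTop (fun _ => c')) :
    TendstoInMeasure μ (fun n ω => (U n ω, U' n ω)) atTop (fun _ => (c, c')) := by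
  rw [tendstoInMeasure_const_iff] at *
  intro s hs
  obtain ⟨t, ht, t', ht', hsub⟩ := mem_nhds_prod_iff.1 hs
  refine tendsto_measure_zero_of_subset_union (Eventually.of_forall fun n ω hω => ?_)
    (hU t ht) (hU' t' ht')
  by_contra hcon
  simp only [Set.mem_union, Set.mem_ofPred_eq, not_or, not_not] at hcon
  exact hω (hsub ⟨hcon.1, hcon.2⟩)

/-- Two sequences which agree on an event of asymptotic probability one have the same limit in
probability. -/
theorem tendstoInMeasure_of_eq_on_event {E E' : Type*} [PseudoMetricSpace E] [PseudoMetricSpace E']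
    {U U' : ℕ → Ω → E} {V : ℕ → Ω → E'} {c : E} {v : E'} {s : Set E'} (hs : s ∈ 𝓝 v)
    (hV : TendstoInMeasure μ V atTop (fun _ => v))
    (hU : TendstoInMeasure μ U atTop (fun _ => c))
    (heq : ∀ᶠ n in atTop, ∀ ω, V n ω ∈ s → U n ω = U' n ω) :
    TendstoInMeasure μ U' atTop (fun _ => c) := by
  rw [tendstoInMeasure_const_iff] at *
  intro t ht
  refine tendsto_measure_zero_of_subset_union ?_ (hU t ht) (hV s hs)
  filter_upwards [heq] with n hn ω hω
  by_contra hcon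
  simp only [Set.mem_union, Set.mem_ofPred_eq, not_or, not_not] at hcon
  exact hω (hn ω hcon.2 ▸ hcon.1)

theorem tendstoInMeasure_of_tendsto_integral_sq [IsFiniteMeasure μ] {U : ℕ → Ω → ℝ} {c : ℝ}
    (hint : ∀ n, Integrable (fun ω => (U n ω - c) ^ 2) μ)
    (h : Tendsto (fun n => ∫ ω, (U n ω - c) ^ 2 ∂μ) atTop (𝓝 0)) :
    TendstoInMeasure μ U atTop (fun _ => c) := by
  rw [tendstoInMeasure_iff_measureReal_norm]
  intro ε hε
  have h' : Tendsto (fun n => (ε ^ 2)⁻¹ * ∫ ω, (U n ω - c) ^ 2 ∂μ) atTop (𝓝 0) := by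
    simpa using h.const_mul (ε ^ 2)⁻¹
  refine squeeze_zero (fun n => measureReal_nonneg) (fun n => ?_) h'
  have h1 := mul_meas_ge_le_integral_of_nonneg (μ := μ)
    (ae_of_all _ fun ω => sq_nonneg (U n ω - c)) (hint n) (ε ^ 2)
  rw [le_inv_mul_iff₀ (by positivity)]
  refine le_trans ?_ h1
  gcongr ?_ * ?_
  refine measureReal_mono (fun ω hω => ?_) (measure_ne_top _ _)
  simp only [Set.mem_ofPred_eq, Real.norm_eq_abs] at *
  rw [← sq_abs (U n ω - c)]
  gcongr

/-- A sequence tending to zero in probability, times an `L¹`-bounded sequence. -/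
theorem tendstoInMeasure_zero_of_abs_le_mul [IsFiniteMeasure μ] {U T W : ℕ → Ω → ℝ} {C : ℝ}
    (hU : TendstoInMeasure μ U atTop (fun _ => 0)) (hT : ∀ n ω, 0 ≤ T n ω)
    (hTi : ∀ n, Integrable (T n) μ) (hTC : ∀ᶠ n in atTop, ∫ ω, T n ω ∂μ ≤ C)
    (hW : ∀ n ω, |W n ω| ≤ |U n ω| * T n ω) :
    TendstoInMeasure μ W atTop (fun _ => 0) := by
  rw [tendstoInMeasure_iff_measureReal_norm] at *
  intro ε hε
  rw [Metric.tendsto_atTop]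
  intro η hη
  simp only [sub_zero, Real.norm_eq_abs] at *
  -- Markov level: the event `M ≤ T n` has probability at most `C / M < η / 2`.
  set M := 2 * (|C| + 1) / η
  have hM : 0 < M := by positivity
  have h1 := (hU (ε / M) (by positivity)).eventually_lt_const (half_pos hη)
  obtain ⟨N, hN⟩ := eventually_atTop.1 (h1.and hTC)
  refine ⟨N, fun n hn => ?_⟩
  obtain ⟨ha, hb⟩ := hN n hn
  rw [Real.dist_eq, sub_zero, abs_of_nonneg measureReal_nonneg]
  have h2 : μ.real {ω | M ≤ T n ω} < η / 2 := by
    have h3 := mul_meas_ge_le_integral_of_nonneg (μ := μ) (ae_of_all _ fun ω => hT n ω) (hTi n) M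
    have h4 : μ.real {ω | M ≤ T n ω} ≤ C / M := by
      rw [le_div_iff₀ hM, mul_comm]
      exact h3.trans hb
    refine h4.trans_lt ?_
    rw [div_lt_iff₀ hM]
    have : η / 2 * M = |C| + 1 := by
      simp only [M]
      field_simp
    rw [this]
    linarith [le_abs_self C]
  have hsub : {ω | ε ≤ |W n ω|} ⊆ {ω | ε / M ≤ |U n ω|} ∪ {ω | M ≤ T n ω} := fun ω hω => by
    by_contra hcon
    simp only [Set.mem_union, Set.mem_ofPred_eq, not_or, not_le] at hcon hω
    have h5 : |U n ω| * T n ω < ε / M * M :=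
      mul_lt_mul'' hcon.1 hcon.2 (abs_nonneg _) (hT n ω)
    rw [div_mul_cancel₀ _ hM.ne'] at h5
    exact absurd (hω.trans (hW n ω)) (not_le.2 h5)
  have h6 := (measureReal_mono (μ := μ) hsub (measure_ne_top _ _)).trans (measureReal_union_le _ _)
  linarith

end ConvergenceInMeasure

/-! ### Sums of i.i.d. variables: moments and the central limit theorem -/

section IIDSums

variable {Ω 𝒵 : Type*} [MeasurableSpace Ω] [MeasurableSpace 𝒵] {μ : Measure Ω}
  {Z : ℕ → Ω → 𝒵}

theorem integral_sum_eq (hident : ∀ i, IdentDistrib (Z i) (Z 0) μ μ) {ψ : 𝒵 → ℝ}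
    (hψ : Measurable ψ) (hi : Integrable (fun ω => ψ (Z 0 ω)) μ) (n : ℕ) :
    Integrable (fun ω => ∑ i ∈ Finset.range n, ψ (Z i ω)) μ ∧
    ∫ ω, ∑ i ∈ Finset.range n, ψ (Z i ω) ∂μ = n * ∫ ω, ψ (Z 0 ω) ∂μ := by
  have hid : ∀ i, IdentDistrib (fun ω => ψ (Z i ω)) (fun ω => ψ (Z 0 ω)) μ μ :=
    fun i => (hident i).comp hψ
  have hI : ∀ i, Integrable (fun ω => ψ (Z i ω)) μ := fun i => (hid i).integrable_iff.2 hi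
  refine ⟨integrable_finsetSum _ fun i _ => hI i, ?_⟩
  rw [integral_finsetSum _ fun i _ => hI i, Finset.sum_congr rfl fun i _ => (hid i).integral_eq]
  simp

variable [IsProbabilityMeasure μ]

/-- Decomposition into variance and squared bias around `c`; pairwise independence gives `n` times a
single variance, which is bounded by the second moment. -/
theorem integral_sq_sum_sub_le (hindep : iIndepFun Z μ)
    (hident : ∀ i, IdentDistrib (Z i) (Z 0) μ μ) {ψ : 𝒵 → ℝ} (hψ : Measurable ψ)
    (hL2 : MemLp (fun ω => ψ (Z 0 ω)) 2 μ) (n : ℕ) (c : ℝ) :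
    Integrable (fun ω => (∑ i ∈ Finset.range n, ψ (Z i ω) - c) ^ 2) μ ∧
    ∫ ω, (∑ i ∈ Finset.range n, ψ (Z i ω) - c) ^ 2 ∂μ ≤
      n * ∫ ω, ψ (Z 0 ω) ^ 2 ∂μ + (n * ∫ ω, ψ (Z 0 ω) ∂μ - c) ^ 2 := by
  have hid : ∀ i, IdentDistrib (fun ω => ψ (Z i ω)) (fun ω => ψ (Z 0 ω)) μ μ :=
    fun i => (hident i).comp hψ
  have hL : ∀ i, MemLp (fun ω => ψ (Z i ω)) 2 μ := fun i => (hid i).symm.memLp_snd hL2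
  have hS : MemLp (fun ω => ∑ i ∈ Finset.range n, ψ (Z i ω)) 2 μ :=
    memLp_finsetSum _ fun i _ => hL i
  have hSc : MemLp (fun ω => ∑ i ∈ Finset.range n, ψ (Z i ω) - c) 2 μ := hS.sub (memLp_const c)
  refine ⟨hSc.integrable_sq, ?_⟩
  have hvar : Var[fun ω => ∑ i ∈ Finset.range n, ψ (Z i ω); μ] =
      n * Var[fun ω => ψ (Z 0 ω); μ] := by
    have h1 := IndepFun.variance_sum (μ := μ) (X := fun i ω => ψ (Z i ω)) (s := Finset.range n)
      (fun i _ => hL i) (fun i _ j _ hij => (hindep.comp (fun _ => ψ) (fun _ => hψ)).indepFun hij)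
    have h2 : (∑ i ∈ Finset.range n, fun ω => ψ (Z i ω)) =
        fun ω => ∑ i ∈ Finset.range n, ψ (Z i ω) := by
      ext ω
      simp
    rw [h2] at h1
    rw [h1, Finset.sum_congr rfl fun i _ => (hid i).variance_eq]
    simp
  have hmean : ∫ ω, (∑ i ∈ Finset.range n, ψ (Z i ω) - c) ∂μ = n * ∫ ω, ψ (Z 0 ω) ∂μ - c := by
    rw [integral_sub (hS.integrable (by norm_num)) (integrable_const c),
      integral_finsetSum _ fun i _ => (hL i).integrable (by norm_num),
      Finset.sum_congr rfl fun i _ => (hid i).integral_eq]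
    simp
  have hv := variance_eq_sub hSc
  have hv' := variance_sub_const (μ := μ) hS.aestronglyMeasurable c
  rw [hvar] at hv'
  rw [hv'] at hv
  have hv0 := variance_eq_sub hL2
  simp only [Pi.pow_apply] at hv hv0
  rw [hmean] at hv
  have h3 : (n : ℝ) * Var[fun ω => ψ (Z 0 ω); μ] ≤ n * ∫ ω, ψ (Z 0 ω) ^ 2 ∂μ := by
    gcongr
    rw [hv0]
    linarith [sq_nonneg (∫ ω, ψ (Z 0 ω) ∂μ)]
  linarith

/-- The cubic Taylor remainder `|t V|³` is bounded by `|t|³ c V²`. Paying one factor of `V` with the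
uniform bound `c` leaves a multiple of the variance, so in a triangular array `n` times the error
still vanishes as `c → 0`, and no third moment is needed. -/
theorem norm_charFun_sub_le {V : Ω → ℝ} (hV : Measurable V) {c t : ℝ} (hc : ∀ ω, |V ω| ≤ c)
    (htc : |t| * c ≤ 1) (h0 : ∫ ω, V ω ∂μ = 0) :
    ‖charFun (μ.map V) t - 1 - ((-(t ^ 2 * (∫ ω, V ω ^ 2 ∂μ) / 2) : ℝ) : ℂ)‖ ≤
      |t| ^ 3 * c * ∫ ω, V ω ^ 2 ∂μ := by
  have hVi : Integrable V μ := Integrable.of_bound hV.aestronglyMeasurable c (ae_of_all _ hc)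
  have hc0 : ∀ ω, V ω ^ 2 ≤ c ^ 2 := fun ω => by
    rw [← sq_abs]
    gcongr
    exact hc ω
  have hV2 : Integrable (fun ω => V ω ^ 2) μ :=
    Integrable.of_bound (hV.pow_const 2).aestronglyMeasurable (c ^ 2)
      (ae_of_all _ fun ω => by rw [Real.norm_of_nonneg (sq_nonneg _)]; exact hc0 ω)
  have hexp : Integrable (fun ω => Complex.exp (t * V ω * Complex.I)) μ := by
    refine Integrable.of_bound (by fun_prop) 1 (ae_of_all _ fun ω => ?_)
    rw [← Complex.ofReal_mul, Complex.norm_exp_ofReal_mul_I]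
  have hcf : charFun (μ.map V) t = ∫ ω, Complex.exp (t * V ω * Complex.I) ∂μ := by
    rw [charFun_apply_real, integral_map hV.aemeasurable (by fun_prop)]
  have hpoly : Integrable (fun ω => (1 : ℂ) + t * Complex.I * (V ω : ℂ) -
      (t ^ 2 / 2 : ℂ) * ((V ω ^ 2 : ℝ) : ℂ)) μ :=
    ((integrable_const _).add (hVi.ofReal.const_mul _)).sub (hV2.ofReal.const_mul _)
  have hpi : ∫ ω, ((1 : ℂ) + t * Complex.I * (V ω : ℂ) -
      (t ^ 2 / 2 : ℂ) * ((V ω ^ 2 : ℝ) : ℂ)) ∂μ =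
      1 + ((-(t ^ 2 * (∫ ω, V ω ^ 2 ∂μ) / 2) : ℝ) : ℂ) := by
    rw [integral_sub ((integrable_const _).add (hVi.ofReal.const_mul _)) (hV2.ofReal.const_mul _),
      integral_add (integrable_const _) (hVi.ofReal.const_mul _), integral_const_mul,
      integral_const_mul, integral_complex_ofReal, integral_complex_ofReal, h0]
    simp
    ring
  rw [sub_sub, ← hpi, hcf, ← integral_sub hexp hpoly, ← integral_const_mul]
  refine norm_integral_le_of_norm_le (hV2.const_mul _) (ae_of_all _ fun ω => ?_)
  have hn : ‖(t * V ω * Complex.I : ℂ)‖ = |t| * |V ω| := by simp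
  have hle : |t| * |V ω| ≤ |t| * c := by gcongr; exact hc ω
  have hb := Complex.exp_bound (x := t * V ω * Complex.I) (hn ▸ hle.trans htc) (n := 3)
    (by norm_num)
  have hsum : ∑ m ∈ Finset.range 3, (t * V ω * Complex.I : ℂ) ^ m / (m.factorial : ℂ) =
      (1 : ℂ) + t * Complex.I * (V ω : ℂ) - (t ^ 2 / 2 : ℂ) * ((V ω ^ 2 : ℝ) : ℂ) := by
    simp [Finset.sum_range_succ, mul_pow]
    ring
  rw [hsum, hn] at hb
  refine hb.trans ?_
  have h1 : ((Nat.succ 3 : ℕ) : ℝ) * ((Nat.factorial 3 : ℝ) * (3 : ℕ))⁻¹ ≤ 1 := by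
    norm_num [Nat.factorial]
  calc (|t| * |V ω|) ^ 3 * _ ≤ (|t| * |V ω|) ^ 3 * 1 := by gcongr
    _ = |t| ^ 3 * |V ω| * V ω ^ 2 := by rw [← sq_abs (V ω)]; ring
    _ ≤ |t| ^ 3 * c * V ω ^ 2 := by gcongr; exact hc ω

/-- Central limit theorem for row sums of uniformly small, bounded, independent and identically
distributed triangular arrays. -/
theorem tendstoInDistribution_sum_of_bounded (hindep : iIndepFun Z μ)
    (hident : ∀ i, IdentDistrib (Z i) (Z 0) μ μ) (hZ : ∀ i, Measurable (Z i)) {ψ : ℕ → 𝒵 → ℝ}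
    (hψ : ∀ n, Measurable (ψ n)) {c : ℕ → ℝ} (hc : Tendsto c atTop (𝓝 0))
    (hb : ∀ n z, |ψ n z| ≤ c n) (h0 : ∀ n, ∫ ω, ψ n (Z 0 ω) ∂μ = 0) {v : ℝ} (hv : 0 ≤ v)
    (hvar : Tendsto (fun n : ℕ => n * ∫ ω, ψ n (Z 0 ω) ^ 2 ∂μ) atTop (𝓝 v)) :
    TendstoInDistribution (fun n ω => ∑ i ∈ Finset.range n, ψ n (Z i ω)) atTop (id : ℝ → ℝ)
      (fun _ => μ) (gaussianReal 0 v.toNNReal) where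
  forall_aemeasurable n :=
    (Finset.measurable_sum _ fun i _ => (hψ n).comp (hZ i)).aemeasurable
  aemeasurable_limit := aemeasurable_id
  tendsto := by
    refine ProbabilityMeasure.tendsto_iff_tendsto_charFun.2 fun t => ?_
    have hm : ∀ n i, Measurable fun ω => ψ n (Z i ω) := fun n i => (hψ n).comp (hZ i)
    have hcf : ∀ n, charFun (μ.map fun ω => ∑ i ∈ Finset.range n, ψ n (Z i ω)) t =
        (1 + (charFun (μ.map fun ω => ψ n (Z 0 ω)) t - 1)) ^ n := fun n => by
      have hi : iIndepFun (fun i ω => ψ n (Z i ω)) μ := hindep.comp (fun _ => ψ n) fun _ => hψ n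
      rw [(hi.restrict _).charFun_map_fun_finsetSum_eq_prod fun i _ => (hm n i).aemeasurable]
      have : ∀ i, μ.map (fun ω => ψ n (Z i ω)) = μ.map (fun ω => ψ n (Z 0 ω)) :=
        fun i => ((hident i).comp (hψ n)).map_eq
      simp [this]
    simp only [ProbabilityMeasure.coe_mk, Measure.map_id, hcf, charFun_gaussianReal]
    -- It remains to find the limit of `n (charFun - 1)`: the quadratic part converges by `hvar`,
    -- the error by the smallness of `c n`.
    refine Complex.tendsto_one_add_pow_exp_of_tendsto ?_
    have hlim : Tendsto (fun n : ℕ =>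
        (n : ℂ) * ((-(t ^ 2 * (∫ ω, ψ n (Z 0 ω) ^ 2 ∂μ) / 2) : ℝ) : ℂ)) atTop
        (𝓝 (t * (0 : ℝ) * Complex.I - (v.toNNReal : ℝ) * t ^ 2 / 2)) := by
      have h1 : Tendsto (fun n : ℕ => ((-(t ^ 2 / 2) * (n * ∫ ω, ψ n (Z 0 ω) ^ 2 ∂μ) : ℝ) : ℂ))
          atTop (𝓝 ((-(t ^ 2 / 2) * v : ℝ) : ℂ)) :=
        (Complex.continuous_ofReal.tendsto _).comp (hvar.const_mul _)
      rw [Real.coe_toNNReal v hv]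
      refine (h1.congr fun n => ?_).trans_eq ?_
      · push_cast
        ring
      · push_cast
        ring_nf
    have herr : Tendsto (fun n : ℕ => (n : ℂ) * (charFun (μ.map fun ω => ψ n (Z 0 ω)) t - 1) -
        (n : ℂ) * ((-(t ^ 2 * (∫ ω, ψ n (Z 0 ω) ^ 2 ∂μ) / 2) : ℝ) : ℂ)) atTop (𝓝 0) := by
      have hz : Tendsto (fun n : ℕ => |t| ^ 3 * c n * (n * ∫ ω, ψ n (Z 0 ω) ^ 2 ∂μ)) atTop
          (𝓝 0) := by
        simpa using (hc.const_mul (|t| ^ 3)).mul hvar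
      refine squeeze_zero_norm' ?_ hz
      have hsmall : Tendsto (fun n => |t| * c n) atTop (𝓝 0) := by simpa using hc.const_mul |t|
      filter_upwards [hsmall.eventually_le_const one_pos] with n hn
      rw [← mul_sub, norm_mul]
      have h2 := norm_charFun_sub_le (μ := μ) (hm n 0) (fun ω => hb n _) hn (h0 n)
      calc _ ≤ ‖(n : ℂ)‖ * (|t| ^ 3 * c n * ∫ ω, ψ n (Z 0 ω) ^ 2 ∂μ) := by gcongr
        _ = _ := by rw [Complex.norm_natCast]; ring
    have h3 := herr.add hlim
    simpa using h3

end IIDSums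

/-- Only the law of the limit matters for convergence in distribution. -/
theorem tendstoInDistribution_of_map_eq {Ω Ω₁ Ω₂ : Type*} [MeasurableSpace Ω]
    [MeasurableSpace Ω₁] [MeasurableSpace Ω₂] {μ : Measure Ω} [IsProbabilityMeasure μ]
    {μ₁ : Measure Ω₁} [IsProbabilityMeasure μ₁] {μ₂ : Measure Ω₂} [IsProbabilityMeasure μ₂]
    {X : ℕ → Ω → ℝ} {Z₁ : Ω₁ → ℝ} {Z₂ : Ω₂ → ℝ}
    (h : TendstoInDistribution X atTop Z₁ (fun _ => μ) μ₁) (hZ₂ : AEMeasurable Z₂ μ₂)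
    (hlaw : μ₁.map Z₁ = μ₂.map Z₂) :
    TendstoInDistribution X atTop Z₂ (fun _ => μ) μ₂ where
  forall_aemeasurable := h.forall_aemeasurable
  aemeasurable_limit := hZ₂
  tendsto := by
    refine h.tendsto.trans_eq ?_
    congr 1
    exact Subtype.ext hlaw

/-! ### Minimization of the asymptotic mean square error -/

section OptimalBandwidths

/-- Squared bias plus variance, as a function of the sample size and of the two bandwidths. -/
noncomputable def meanSquareProfile (d : ℕ) (α β γ N s t : ℝ) : ℝ :=
  (s ^ 2 * α + t ^ 2 * β) ^ 2 + γ / (N * s ^ d * t)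

/-- In coordinates `t₀ = c₀ exp u`, `t₁ = c₁ exp v` the profile is a positive combination of
exponentials of linear forms. The hypotheses `hbal` and `hcrit` say that `u = v = 0` is critical, so
the linear terms cancel and the excess over the value there is a positive combination of terms `exp
z - (z + 1) ≥ 0`. The terms in `4 u` and `4 v` alone already force uniqueness. -/
theorem meanSquareProfile_one_min {d : ℕ} {α β γ c₀ c₁ : ℝ} (hα : 0 < α) (hβ : 0 < β)
    (hγ : 0 < γ) (hc₀ : 0 < c₀) (hc₁ : 0 < c₁) (hbal : c₀ ^ 2 * α = d * (c₁ ^ 2 * β))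
    (hcrit : 4 * (d + 1) * (c₁ ^ 2 * β) ^ 2 = γ / (c₀ ^ d * c₁)) {t₀ t₁ : ℝ} (ht₀ : 0 < t₀)
    (ht₁ : 0 < t₁) :
    meanSquareProfile d α β γ 1 c₀ c₁ ≤ meanSquareProfile d α β γ 1 t₀ t₁ ∧
    (meanSquareProfile d α β γ 1 t₀ t₁ ≤ meanSquareProfile d α β γ 1 c₀ c₁ →
      t₀ = c₀ ∧ t₁ = c₁) := by
  obtain ⟨u, rfl⟩ : ∃ u, t₀ = c₀ * Real.exp u :=
    ⟨Real.log (t₀ / c₀), by rw [Real.exp_log (by positivity)]; field_simp⟩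
  obtain ⟨v, rfl⟩ : ∃ v, t₁ = c₁ * Real.exp v :=
    ⟨Real.log (t₁ / c₁), by rw [Real.exp_log (by positivity)]; field_simp⟩
  set p := c₀ ^ 2 * α with hp
  set q := c₁ ^ 2 * β with hq
  have hp0 : 0 < p := by positivity
  have hq0 : 0 < q := by positivity
  set w := γ / (c₀ ^ d * c₁) with hw
  have hw0 : 0 < w := by positivity
  have hA : meanSquareProfile d α β γ 1 (c₀ * Real.exp u) (c₁ * Real.exp v) =
      p ^ 2 * Real.exp (4 * u) + 2 * p * q * Real.exp (2 * u + 2 * v) +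
        q ^ 2 * Real.exp (4 * v) + w * Real.exp (-(d * u) - v) := by
    have e1 : Real.exp (4 * u) = Real.exp u ^ 4 := by rw [← Real.exp_nat_mul]; norm_num
    have e2 : Real.exp (4 * v) = Real.exp v ^ 4 := by rw [← Real.exp_nat_mul]; norm_num
    have e3 : Real.exp (2 * u + 2 * v) = Real.exp u ^ 2 * Real.exp v ^ 2 := by
      rw [Real.exp_add, ← Real.exp_nat_mul, ← Real.exp_nat_mul]; norm_num
    have e4 : Real.exp (-(d * u) - v) = (Real.exp u ^ d * Real.exp v)⁻¹ := by
      rw [← Real.exp_nat_mul, ← Real.exp_add, ← Real.exp_neg]; congr 1; ring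
    rw [e1, e2, e3, e4, meanSquareProfile, hw, hp, hq]
    field_simp
    ring
  have hC : meanSquareProfile d α β γ 1 c₀ c₁ = p ^ 2 + 2 * p * q + q ^ 2 + w := by
    rw [meanSquareProfile, hw, hp, hq]
    ring
  -- Vanishing of the derivatives in `u` (here) and in `v` (next) at the origin.
  have hd1 : 4 * p ^ 2 + 2 * (2 * p * q) = d * w := by
    rw [← hcrit, hbal]; ring
  have hd2 : 2 * (2 * p * q) + 4 * q ^ 2 = w := by
    rw [← hcrit, hbal]; ring
  have hdiff : meanSquareProfile d α β γ 1 (c₀ * Real.exp u) (c₁ * Real.exp v) -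
      meanSquareProfile d α β γ 1 c₀ c₁ =
      p ^ 2 * (Real.exp (4 * u) - (4 * u + 1)) +
        2 * p * q * (Real.exp (2 * u + 2 * v) - (2 * u + 2 * v + 1)) +
        q ^ 2 * (Real.exp (4 * v) - (4 * v + 1)) +
        w * (Real.exp (-(d * u) - v) - (-(d * u) - v + 1)) := by
    rw [hA, hC]
    linear_combination u * hd1 + v * hd2
  have hnn : ∀ z, 0 ≤ Real.exp z - (z + 1) := fun z => sub_nonneg.2 (Real.add_one_le_exp z)
  have i1 := mul_nonneg (sq_nonneg p) (hnn (4 * u))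
  have i2 := mul_nonneg (by positivity : 0 ≤ 2 * p * q) (hnn (2 * u + 2 * v))
  have i3 := mul_nonneg (sq_nonneg q) (hnn (4 * v))
  have i4 := mul_nonneg hw0.le (hnn (-(d * u) - v))
  refine ⟨by linarith, fun hle => ?_⟩
  have hzero : ∀ (a z : ℝ), 0 < a → a ^ 2 * (Real.exp (4 * z) - (4 * z + 1)) ≤ 0 → z = 0 := by
    intro a z ha hz
    by_contra hne
    have h1 := Real.add_one_lt_exp (mul_ne_zero four_ne_zero hne)
    have h2 : 0 < a ^ 2 * (Real.exp (4 * z) - (4 * z + 1)) :=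
      mul_pos (by positivity) (sub_pos.2 h1)
    linarith
  rw [hzero p u hp0 (by linarith), hzero q v hq0 (by linarith)]
  simp

theorem exists_balanced_bandwidths {d : ℕ} (hd : 1 ≤ d) {α β γ : ℝ} (hα : 0 < α) (hβ : 0 < β)
    (hγ : 0 < γ) :
    ∃ c₀ > (0 : ℝ), ∃ c₁ > (0 : ℝ), c₀ ^ 2 * α = d * (c₁ ^ 2 * β) ∧
      4 * (d + 1) * (c₁ ^ 2 * β) ^ 2 = γ / (c₀ ^ d * c₁) := by
  have hd0 : (0 : ℝ) < d := by exact_mod_cast hd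
  -- The first equation fixes the ratio `c₀ / c₁ = κ`; substituting it, the second becomes `c₁ ^ (d
  -- + 5) = B`.
  set κ := √(d * β / α)
  have hκ : 0 < κ := Real.sqrt_pos.2 (by positivity)
  have hκ2 : κ ^ 2 = d * β / α := Real.sq_sqrt (by positivity)
  set B := γ / (4 * β ^ 2 * (d + 1) * κ ^ d)
  have hB : 0 < B := by positivity
  set τ := B ^ (((d + 5 : ℕ) : ℝ)⁻¹)
  have hτ : 0 < τ := Real.rpow_pos_of_pos hB _
  have hτ5 : τ ^ (d + 5) = B := Real.rpow_inv_natCast_pow hB.le (by omega)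
  refine ⟨κ * τ, by positivity, τ, hτ, ?_, ?_⟩
  · rw [mul_pow, hκ2]
    field_simp
  · rw [eq_div_iff (by positivity)]
    calc 4 * (d + 1) * (τ ^ 2 * β) ^ 2 * ((κ * τ) ^ d * τ)
        = 4 * β ^ 2 * (d + 1) * κ ^ d * τ ^ (d + 5) := by ring
      _ = γ := by rw [hτ5]; simp only [B]; field_simp

/-- The squared bias is homogeneous of degree `4`. The variance gains `1 / (N ρ^(d+1))`, which
equals `ρ^4` precisely for the exponent `d + 5`. -/
theorem meanSquareProfile_scale {d : ℕ} {α β γ N ρ : ℝ} (hρ : 0 < ρ) (hN : N * ρ ^ (d + 5) = 1)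
    (s t : ℝ) :
    meanSquareProfile d α β γ N (ρ * s) (ρ * t) = ρ ^ 4 * meanSquareProfile d α β γ 1 s t := by
  have hNe : N = (ρ ^ (d + 5))⁻¹ := eq_inv_of_mul_eq_one_left hN
  have h1 : N * (ρ * s) ^ d * (ρ * t) = (1 * s ^ d * t) / ρ ^ 4 := by
    rw [hNe, eq_div_iff (by positivity)]
    field_simp
    ring
  rw [meanSquareProfile, meanSquareProfile, h1, div_div_eq_mul_div]
  ring

/-- The bandwidths minimizing the mean square profile, and the resulting rate. -/
theorem exists_optimal_bandwidths {d : ℕ} (hd : 1 ≤ d) {α β γ : ℝ} (hαβ : 0 < α * β)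
    (hγ : 0 < γ) :
    ∃ c₀ > (0 : ℝ), ∃ c₁ > (0 : ℝ), ∃ C > (0 : ℝ), ∀ n : ℕ, 1 ≤ n →
      (∀ s₀ > (0 : ℝ), ∀ s₁ > (0 : ℝ),
        (∀ t₀ > (0 : ℝ), ∀ t₁ > (0 : ℝ),
          meanSquareProfile d α β γ n s₀ s₁ ≤ meanSquareProfile d α β γ n t₀ t₁) ↔
          s₀ = c₀ * (n : ℝ) ^ (-(1 : ℝ) / (d + 5)) ∧ s₁ = c₁ * (n : ℝ) ^ (-(1 : ℝ) / (d + 5))) ∧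
      √(meanSquareProfile d α β γ n (c₀ * (n : ℝ) ^ (-(1 : ℝ) / (d + 5)))
          (c₁ * (n : ℝ) ^ (-(1 : ℝ) / (d + 5)))) = C * (n : ℝ) ^ (-(2 : ℝ) / (d + 5)) := by
  -- The bias enters squared, so changing the sign of both coefficients changes nothing; `α` and `β`
  -- have the same sign.
  wlog hα : 0 < α generalizing α β
  · have hα' : α < 0 := lt_of_le_of_ne (not_lt.1 hα) fun h => by simp [h] at hαβ
    have h := this (α := -α) (β := -β) (by simpa using hαβ) (by simpa using hα')
    have hneg : ∀ N s t, meanSquareProfile d (-α) (-β) γ N s t = meanSquareProfile d α β γ N s t :=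
      fun N s t => by rw [meanSquareProfile, meanSquareProfile]; ring
    simpa only [hneg] using h
  have hβ : 0 < β := pos_of_mul_pos_right hαβ hα.le
  obtain ⟨c₀, hc₀, c₁, hc₁, hbal, hcrit⟩ := exists_balanced_bandwidths hd hα hβ hγ
  have hpos : 0 < meanSquareProfile d α β γ 1 c₀ c₁ := by
    rw [meanSquareProfile]
    positivity
  refine ⟨c₀, hc₀, c₁, hc₁, √(meanSquareProfile d α β γ 1 c₀ c₁), Real.sqrt_pos.2 hpos,
    fun n hn => ?_⟩
  have hn0 : (0 : ℝ) < n := by exact_mod_cast hn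
  set ρ := (n : ℝ) ^ (-(1 : ℝ) / (d + 5)) with hρdef
  have hρ : 0 < ρ := Real.rpow_pos_of_pos hn0 _
  have hρ2 : (n : ℝ) ^ (-(2 : ℝ) / (d + 5)) = ρ ^ 2 := by
    rw [hρdef, ← Real.rpow_natCast, ← Real.rpow_mul hn0.le]
    congr 1
    push_cast
    ring
  have hN : (n : ℝ) * ρ ^ (d + 5) = 1 := by
    rw [hρdef, ← Real.rpow_natCast, ← Real.rpow_mul hn0.le]
    have : -(1 : ℝ) / (d + 5) * ((d + 5 : ℕ) : ℝ) = -1 := by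
      push_cast
      field_simp
    rw [this, Real.rpow_neg_one, mul_inv_cancel₀ hn0.ne']
  have hscale := meanSquareProfile_scale (α := α) (β := β) (γ := γ) hρ hN
  have hresc : ∀ t : ℝ, t = ρ * (t / ρ) := fun t => by field_simp
  refine ⟨fun s₀ hs₀ s₁ hs₁ => ⟨fun hmin => ?_, ?_⟩, ?_⟩
  · have h1 := hmin (ρ * c₀) (by positivity) (ρ * c₁) (by positivity)
    rw [hresc s₀, hresc s₁, hscale, hscale] at h1
    have h2 := (meanSquareProfile_one_min hα hβ hγ hc₀ hc₁ hbal hcrit (div_pos hs₀ hρ)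
      (div_pos hs₁ hρ)).2 (le_of_mul_le_mul_left h1 (by positivity))
    exact ⟨(div_eq_iff hρ.ne').1 h2.1, (div_eq_iff hρ.ne').1 h2.2⟩
  · rintro ⟨rfl, rfl⟩ t₀ ht₀ t₁ ht₁
    rw [hresc t₀, hresc t₁, mul_comm c₀, mul_comm c₁, hscale, hscale]
    gcongr
    exact (meanSquareProfile_one_min hα hβ hγ hc₀ hc₁ hbal hcrit (div_pos ht₀ hρ)
      (div_pos ht₁ hρ)).1
  · rw [mul_comm c₀, mul_comm c₁, hscale, hρ2, Real.sqrt_mul (by positivity),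
      show ρ ^ 4 = (ρ ^ 2) ^ 2 by ring, Real.sqrt_sq (by positivity), mul_comm]

end OptimalBandwidths

theorem integral_add_eq {α : Type*} [MeasurableSpace α] {ν : Measure α} {q r : α → ℝ} {a b : ℝ}
    (hq : Integrable q ν ∧ ∫ w, q w ∂ν = a) (hr : Integrable r ν ∧ ∫ w, r w ∂ν = b) :
    Integrable (fun w => q w + r w) ν ∧ ∫ w, (q w + r w) ∂ν = a + b :=
  ⟨hq.1.add hr.1, by rw [integral_add hq.1 hr.1, hq.2, hr.2]⟩

/-! ### Moments of the kernels and bias expansions -/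

section Kernels

variable {d : ℕ} {K₀ : Cov d → ℝ} {K₁ : ℝ → ℝ}

theorem KernelConditions.exists_radius (hker : KernelConditions K₀ K₁) :
    ∃ R, ∀ z, K₀ z ≠ 0 → ‖z‖ ≤ R := by
  refine ⟨√(∑ _j : Fin d, (1 / 2 : ℝ) ^ 2), fun z hz => ?_⟩
  rw [EuclideanSpace.norm_eq]
  refine Real.sqrt_le_sqrt (Finset.sum_le_sum fun j _ => ?_)
  gcongr
  exact hker.support_K₀ z hz j

theorem KernelConditions.hasCompactSupport (hker : KernelConditions K₀ K₁) :
    HasCompactSupport K₀ := by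
  obtain ⟨R, hR⟩ := hker.exists_radius
  refine HasCompactSupport.intro (isCompact_closedBall 0 R) fun z hz => ?_
  by_contra hne
  exact hz (by simpa using hR z hne)

theorem exists_radius_of_hasCompactSupport {V : Type*} [NormedAddCommGroup V] {L : V → ℝ}
    (hL : HasCompactSupport L) : ∃ R, ∀ z, L z ≠ 0 → ‖z‖ ≤ R := by
  obtain ⟨R, hR⟩ := hL.isCompact.isBounded.subset_closedBall 0
  exact ⟨R, fun z hz => by simpa using hR (subset_tsupport L hz)⟩

theorem KernelConditions.integral_mul_odd (hker : KernelConditions K₀ K₁) {q : Cov d → ℝ}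
    (hq : ∀ z, q (-z) = -q z) : ∫ z, K₀ z * q z = 0 := by
  have h := integral_neg_eq_self (fun z => K₀ z * q z) volume
  simp only [hker.even_K₀, hq, mul_neg, integral_neg] at h
  linarith

theorem KernelConditions.integral_sq_pos (hker : KernelConditions K₀ K₁) :
    0 < ∫ z, K₀ z ^ 2 := by
  have hc : Continuous fun z => K₀ z ^ 2 := hker.continuous_K₀.pow 2
  have hs : HasCompactSupport fun z => K₀ z ^ 2 :=
    hker.hasCompactSupport.comp_left (g := fun t : ℝ => t ^ 2) (by simp)
  have hne : ∃ z, K₀ z ≠ 0 := by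
    by_contra! h
    simpa [h] using hker.integral_K₀
  obtain ⟨z, hz⟩ := hne
  exact hc.integral_pos_of_hasCompactSupport_nonneg_nonzero hs (fun z => sq_nonneg _)
    (pow_ne_zero 2 hz)

theorem KernelConditions.integral_sq_pos_snd (hker : KernelConditions K₀ K₁) :
    0 < ∫ v, K₁ v ^ 2 := by
  have hc : Continuous fun z => K₁ z ^ 2 := hker.smooth_K₁.continuous.pow 2
  have hs : HasCompactSupport fun z => K₁ z ^ 2 :=
    hker.compact_K₁.comp_left (g := fun t : ℝ => t ^ 2) (by simp)
  have hne : ∃ z, K₁ z ≠ 0 := by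
    by_contra! h
    simpa [h] using hker.integral_K₁
  obtain ⟨z, hz⟩ := hne
  exact hc.integral_pos_of_hasCompactSupport_nonneg_nonzero hs (fun z => sq_nonneg _)
    (pow_ne_zero 2 hz)

theorem KernelConditions.integral_mul_taylorTwo (hker : KernelConditions K₀ K₁) (F : Cov d → ℝ)
    (x : Cov d) (h : ℝ) :
    ∫ z, K₀ z * taylorTwo F x (h • z) =
      F x + h ^ 2 * (1 / 2 * ∫ z, K₀ z * fderiv ℝ (fderiv ℝ F) x z z) := by
  set D := fderiv ℝ F x
  set D2 := fderiv ℝ (fderiv ℝ F) x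
  have hi : ∀ {q : Cov d → ℝ}, Continuous q → Integrable fun z => K₀ z * q z := fun hq =>
    (hker.continuous_K₀.mul hq).integrable_of_hasCompactSupport hker.hasCompactSupport.mul_right
  have h2 : Continuous fun z : Cov d => D2 z z := by fun_prop
  have e : ∀ z, K₀ z * taylorTwo F x (h • z) =
      K₀ z * F x + h * (K₀ z * D z) + h ^ 2 / 2 * (K₀ z * D2 z z) := fun z => by
    simp [taylorTwo, D, D2]
    ring
  simp_rw [e]
  have ia := hi (continuous_const (y := F x))
  have ib := (hi D.continuous).const_mul h
  have ic := (hi h2).const_mul (h ^ 2 / 2)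
  have h0 : ∫ z, K₀ z * D z = 0 := hker.integral_mul_odd fun z => map_neg D z
  refine (integral_add_eq (integral_add_eq ⟨ia, rfl⟩ ⟨ib, rfl⟩) ⟨ic, rfl⟩).2.trans ?_
  rw [integral_mul_const, integral_const_mul, integral_const_mul, hker.integral_K₀, h0]
  ring

/-- A second order even kernel has a quadratic bias. -/
theorem KernelConditions.exists_bias_le (hker : KernelConditions K₀ K₁) {F : Cov d → ℝ}
    {x : Cov d} (hF : Measurable F) (hFx : ContDiffAt ℝ 2 F x) {h : ℕ → ℝ}
    (hpos : ∀ n, 0 < h n) (hlim : Tendsto h atTop (𝓝 0)) :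
    ∃ C, 0 ≤ C ∧ ∀ᶠ n in atTop, |(∫ z, K₀ z * F (x + h n • z)) - F x| ≤ C * h n ^ 2 := by
  obtain ⟨R, hR⟩ := hker.exists_radius
  have hi : Integrable K₀ :=
    hker.continuous_K₀.integrable_of_hasCompactSupport hker.hasCompactSupport
  have ho := integral_kernel_mul_sub_taylorTwo_isLittleO (ν := volume) (A := fun n z => h n • z)
    hi hR hF hFx (fun n => by fun_prop) (fun n => by fun_prop)
    (fun n w => by rw [norm_smul, Real.norm_of_nonneg (hpos n).le]) hlim
  set B := 1 / 2 * ∫ z, K₀ z * fderiv ℝ (fderiv ℝ F) x z z with hB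
  refine ⟨1 + |B|, by positivity, ?_⟩
  filter_upwards [isLittleO_iff.1 ho one_pos] with n hn
  rw [hker.integral_mul_taylorTwo, ← hB, Real.norm_eq_abs, Real.norm_of_nonneg (sq_nonneg _)] at hn
  calc |(∫ z, K₀ z * F (x + h n • z)) - F x|
      = |((∫ z, K₀ z * F (x + h n • z)) - (F x + h n ^ 2 * B)) + h n ^ 2 * B| := by ring_nf
    _ ≤ 1 * h n ^ 2 + h n ^ 2 * |B| := by
        refine (abs_add_le _ _).trans (add_le_add hn ?_)
        rw [abs_mul, abs_of_nonneg (sq_nonneg _)]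
    _ = _ := by ring

theorem tendsto_integral_rescale {L : Cov d → ℝ} (hL : Continuous L) (hLs : HasCompactSupport L)
    {F : Cov d → ℝ} {x : Cov d} (hF : Measurable F) (hFx : ContinuousAt F x) {h : ℕ → ℝ}
    (hpos : ∀ n, 0 < h n) (hlim : Tendsto h atTop (𝓝 0)) :
    Tendsto (fun n => ∫ z, L z * F (x + h n • z)) atTop (𝓝 ((∫ z, L z) * F x)) := by
  obtain ⟨R, hR⟩ := exists_radius_of_hasCompactSupport hLs
  exact tendsto_integral_kernel_mul (A := fun n z => h n • z)
    (hL.integrable_of_hasCompactSupport hLs) hR hF hFx (fun n => by fun_prop)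
    (fun n w => by rw [norm_smul, Real.norm_of_nonneg (hpos n).le]) hlim

theorem norm_rescale_prod_le {h k : ℝ} (hh : 0 < h) (hk : 0 < k) (w : Cov d × ℝ) :
    ‖((h • w.1, k * w.2) : Cov d × ℝ)‖ ≤ max h k * ‖w‖ := by
  rw [Prod.norm_mk]
  refine max_le ?_ ?_
  · rw [norm_smul, Real.norm_of_nonneg hh.le]
    gcongr
    · exact le_max_left _ _
    · exact norm_fst_le w
  · rw [norm_mul, Real.norm_of_nonneg hk.le]
    gcongr
    · exact le_max_right _ _
    · exact norm_snd_le w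

theorem tendsto_integral_rescale_prod {L : Cov d × ℝ → ℝ} (hL : Continuous L)
    (hLs : HasCompactSupport L) {F : Cov d × ℝ → ℝ} {p : Cov d × ℝ} (hF : Measurable F)
    (hFp : ContinuousAt F p) {h k : ℕ → ℝ} (hh : ∀ n, 0 < h n) (hk : ∀ n, 0 < k n)
    (hlim : Tendsto h atTop (𝓝 0)) (klim : Tendsto k atTop (𝓝 0)) :
    Tendsto (fun n => ∫ w, L w * F (p + (h n • w.1, k n * w.2))) atTop
      (𝓝 ((∫ w, L w) * F p)) := by
  obtain ⟨R, hR⟩ := exists_radius_of_hasCompactSupport hLs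
  exact tendsto_integral_kernel_mul (A := fun n w => (h n • w.1, k n * w.2))
    (hL.integrable_of_hasCompactSupport hLs) hR hF hFp (fun n => by fun_prop)
    (fun n w => norm_rescale_prod_le (hh n) (hk n) w) (by simpa using hlim.max klim)

theorem hasCompactSupport_mul_prod {L₀ : Cov d → ℝ} {L₁ : ℝ → ℝ} (h₀ : HasCompactSupport L₀)
    (h₁ : HasCompactSupport L₁) :
    HasCompactSupport fun w : Cov d × ℝ => L₀ w.1 * L₁ w.2 := by
  refine HasCompactSupport.intro (h₀.isCompact.prod h₁.isCompact) fun w hw => ?_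
  by_contra hne
  exact hw ⟨subset_tsupport _ (left_ne_zero_of_mul hne), subset_tsupport _ (right_ne_zero_of_mul hne)⟩

/-- The gradient in the covariate integrates to zero because `K₀` is even. The gradient in `y` and
the mixed second derivatives carry one factor `v` and vanish because `K₁` has zero first moment,
leaving only the two pure second order terms. -/
theorem KernelConditions.integral_mul_taylorTwo_prod (hker : KernelConditions K₀ K₁)
    (F : Cov d × ℝ → ℝ) (p : Cov d × ℝ) (h k : ℝ) :
    ∫ w : Cov d × ℝ, K₀ w.1 * K₁ w.2 * taylorTwo F p (h • w.1, k * w.2) =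
      F p + h ^ 2 * (∫ z, fderiv ℝ (fderiv ℝ F) p (z, 0) (z, 0) * K₀ z) / 2 +
        k ^ 2 * (fderiv ℝ (fderiv ℝ F) p (0, 1) (0, 1) * ∫ v, v ^ 2 * K₁ v) / 2 := by
  set D := fderiv ℝ F p
  set D2 := fderiv ℝ (fderiv ℝ F) p
  have h0 : ∀ {q : Cov d → ℝ}, Continuous q → Integrable fun z => K₀ z * q z := fun hq =>
    (hker.continuous_K₀.mul hq).integrable_of_hasCompactSupport hker.hasCompactSupport.mul_right
  have h1 : ∀ {q : ℝ → ℝ}, Continuous q → Integrable fun z => K₁ z * q z := fun hq =>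
    (hker.smooth_K₁.continuous.mul hq).integrable_of_hasCompactSupport hker.compact_K₁.mul_right
  have hi : ∀ {q : Cov d → ℝ} {r : ℝ → ℝ}, Continuous q → Continuous r →
      Integrable fun w : Cov d × ℝ => (K₀ w.1 * q w.1) * (K₁ w.2 * r w.2) := fun hq hr =>
    (h0 hq).mul_prod (h1 hr)
  have hm : ∀ (q : Cov d → ℝ) (r : ℝ → ℝ),
      ∫ w : Cov d × ℝ, (K₀ w.1 * q w.1) * (K₁ w.2 * r w.2) =
        (∫ z, K₀ z * q z) * ∫ v, K₁ v * r v := fun q r =>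
    integral_prod_mul (fun z => K₀ z * q z) fun v => K₁ v * r v
  have hsplit : ∀ (z : Cov d) (v : ℝ), ((h • z, k * v) : Cov d × ℝ) =
      h • ((z, 0) : Cov d × ℝ) + (k * v) • ((0, 1) : Cov d × ℝ) := fun z v => by simp
  have e : ∀ w : Cov d × ℝ, K₀ w.1 * K₁ w.2 * taylorTwo F p (h • w.1, k * w.2) =
      F p * ((K₀ w.1 * 1) * (K₁ w.2 * 1)) + h * ((K₀ w.1 * D (w.1, 0)) * (K₁ w.2 * 1)) +
      k * D (0, 1) * ((K₀ w.1 * 1) * (K₁ w.2 * w.2)) +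
      h ^ 2 / 2 * ((K₀ w.1 * D2 (w.1, 0) (w.1, 0)) * (K₁ w.2 * 1)) +
      h * k / 2 * ((K₀ w.1 * (D2 (w.1, 0) (0, 1) + D2 (0, 1) (w.1, 0))) * (K₁ w.2 * w.2)) +
      k ^ 2 / 2 * D2 (0, 1) (0, 1) * ((K₀ w.1 * 1) * (K₁ w.2 * w.2 ^ 2)) := fun w => by
    rw [hsplit]
    simp only [taylorTwo, map_add, map_smul, add_apply, smul_apply, smul_eq_mul]
    ring
  have c1 : Continuous fun z : Cov d => D (z, 0) := by fun_prop
  have c2 : Continuous fun z : Cov d => D2 (z, 0) (z, 0) := by fun_prop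
  have c3 : Continuous fun z : Cov d => D2 (z, 0) (0, 1) + D2 (0, 1) (z, 0) := by fun_prop
  have cc0 : Continuous fun _ : Cov d => (1 : ℝ) := continuous_const
  have cc1 : Continuous fun _ : ℝ => (1 : ℝ) := continuous_const
  have ci : Continuous fun v : ℝ => v := continuous_id
  have cs : Continuous fun v : ℝ => v ^ 2 := by fun_prop
  have i1 := (hi cc0 cc1).const_mul (F p)
  have i2 := (hi c1 cc1).const_mul h
  have i3 := (hi cc0 ci).const_mul (k * D (0, 1))
  have i4 := (hi c2 cc1).const_mul (h ^ 2 / 2)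
  have i5 := (hi c3 ci).const_mul (h * k / 2)
  have i6 := (hi cc0 cs).const_mul (k ^ 2 / 2 * D2 (0, 1) (0, 1))
  have z1 : ∫ z, K₀ z * D (z, 0) = 0 := hker.integral_mul_odd fun z => by
    rw [← map_neg]
    simp
  have z2 : ∫ v, K₁ v * v = 0 := by
    simpa only [mul_comm] using hker.first_moment_K₁
  simp_rw [e]
  refine (integral_add_eq (integral_add_eq (integral_add_eq (integral_add_eq (integral_add_eq
    ⟨i1, rfl⟩ ⟨i2, rfl⟩) ⟨i3, rfl⟩) ⟨i4, rfl⟩) ⟨i5, rfl⟩) ⟨i6, rfl⟩).2.trans ?_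
  simp only [integral_const_mul]
  rw [hm (fun _ => 1) (fun _ => 1), hm (fun z => D (z, 0)) (fun _ => 1),
    hm (fun _ => 1) (fun v => v), hm (fun z => D2 (z, 0) (z, 0)) (fun _ => 1),
    hm (fun z => D2 (z, 0) (0, 1) + D2 (0, 1) (z, 0)) (fun v => v),
    hm (fun _ => 1) (fun v => v ^ 2), z1, z2]
  simp only [mul_one, hker.integral_K₀, hker.integral_K₁]
  simp only [mul_comm (K₀ _) _, mul_comm (K₁ _) _]
  ring

theorem iteratedFDeriv_two_fst {F : Cov d × ℝ → ℝ} (hF : ContDiff ℝ 2 F) (x z : Cov d) (y : ℝ) :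
    iteratedFDeriv ℝ 2 (fun u => F (u, y)) x ![z, z] =
      fderiv ℝ (fderiv ℝ F) (x, y) (z, 0) (z, 0) := by
  have hd1 : Differentiable ℝ F := hF.differentiable (by simp)
  have hd2 : Differentiable ℝ (fderiv ℝ F) :=
    (hF.fderiv_right (m := 1) (by norm_num)).differentiable (by simp)
  have hι : ∀ u : Cov d, HasFDerivAt (fun u => ((u, y) : Cov d × ℝ))
      (ContinuousLinearMap.inl ℝ (Cov d) ℝ) u := fun u => hasFDerivAt_prodMk_left u y
  have h1 : fderiv ℝ (fun u => F (u, y)) = fun u =>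
      (fderiv ℝ F (u, y)).comp (ContinuousLinearMap.inl ℝ (Cov d) ℝ) :=
    funext fun u => ((hd1 (u, y)).hasFDerivAt.comp u (hι u)).fderiv
  have h2 : HasFDerivAt (fun u => fderiv ℝ F (u, y))
      ((fderiv ℝ (fderiv ℝ F) (x, y)).comp (ContinuousLinearMap.inl ℝ (Cov d) ℝ)) x :=
    (hd2 (x, y)).hasFDerivAt.comp x (hι x)
  have h3 := h2.clm_comp (hasFDerivAt_const (ContinuousLinearMap.inl ℝ (Cov d) ℝ) x)
  rw [iteratedFDeriv_two_apply, h1, h3.fderiv]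
  simp

theorem iteratedDeriv_two_snd {F : Cov d × ℝ → ℝ} (hF : ContDiff ℝ 2 F) (x : Cov d) (y : ℝ) :
    iteratedDeriv 2 (fun t => F (x, t)) y = fderiv ℝ (fderiv ℝ F) (x, y) (0, 1) (0, 1) := by
  have hd1 : Differentiable ℝ F := hF.differentiable (by simp)
  have hd2 : Differentiable ℝ (fderiv ℝ F) :=
    (hF.fderiv_right (m := 1) (by norm_num)).differentiable (by simp)
  have hι : ∀ t : ℝ, HasDerivAt (fun t => ((x, t) : Cov d × ℝ)) (0, 1) t := fun t =>
    (hasDerivAt_const t x).prodMk (hasDerivAt_id t)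
  have h1 : deriv (fun t => F (x, t)) = fun t => fderiv ℝ F (x, t) (0, 1) :=
    funext fun t => ((hd1 (x, t)).hasFDerivAt.comp_hasDerivAt t (hι t)).deriv
  have h2 : HasDerivAt (fun t => fderiv ℝ F (x, t)) (fderiv ℝ (fderiv ℝ F) (x, y) (0, 1)) y :=
    (hd2 (x, y)).hasFDerivAt.comp_hasDerivAt y (hι y)
  have h3 := h2.clm_apply (hasDerivAt_const y ((0, 1) : Cov d × ℝ))
  rw [iteratedDeriv_succ, iteratedDeriv_one, h1, h3.deriv]
  simp

/-- The smoothed joint density, expanded to the second order in the bandwidths. -/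
theorem KernelConditions.smoothed_density_expansion (hker : KernelConditions K₀ K₁)
    {φ : Cov d × ℝ → ℝ} (hφ : ContDiff ℝ 2 φ) (m : Cov d → ℝ) (x : Cov d) (e : ℝ)
    {h k : ℕ → ℝ} (hh : ∀ n, 0 < h n) (hk : ∀ n, 0 < k n)
    (hlim : Tendsto h atTop (𝓝 0)) (klim : Tendsto k atTop (𝓝 0)) :
    (fun n => (∫ w : Cov d × ℝ, K₀ w.1 * K₁ w.2 * φ ((x, m x + e) + (h n • w.1, k n * w.2))) -
      (φ (x, m x + e) + h n ^ 2 * mu1 K₀ m φ x e / 2 + k n ^ 2 * mu2 K₁ m φ x e / 2))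
      =o[atTop] fun n => h n ^ 2 + k n ^ 2 := by
  have hLc : Continuous fun w : Cov d × ℝ => K₀ w.1 * K₁ w.2 :=
    (hker.continuous_K₀.comp continuous_fst).mul (hker.smooth_K₁.continuous.comp continuous_snd)
  have hLs := hasCompactSupport_mul_prod hker.hasCompactSupport hker.compact_K₁
  obtain ⟨R, hR⟩ := exists_radius_of_hasCompactSupport hLs
  have ho := integral_kernel_mul_sub_taylorTwo_isLittleO (p := (x, m x + e)) (ν := volume)
    (A := fun n (w : Cov d × ℝ) => (h n • w.1, k n * w.2))
    (hLc.integrable_of_hasCompactSupport hLs) hR hφ.continuous.measurable hφ.contDiffAt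
    (fun n => by fun_prop) (fun n => by fun_prop)
    (fun n w => norm_rescale_prod_le (hh n) (hk n) w)
    (by simpa using hlim.max klim : Tendsto (fun n => max (h n) (k n)) atTop (𝓝 0))
  -- The Taylor error is controlled by the larger bandwidth, whose square is one of the two
  -- summands.
  have hO : (fun n => max (h n) (k n) ^ 2) =O[atTop] fun n => h n ^ 2 + k n ^ 2 := by
    refine IsBigO.of_bound 1 (Eventually.of_forall fun n => ?_)
    rw [one_mul, Real.norm_of_nonneg (sq_nonneg _), Real.norm_of_nonneg (by positivity)]
    rcases max_choice (h n) (k n) with hmax | hmax <;> rw [hmax]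
    · linarith [sq_nonneg (k n)]
    · linarith [sq_nonneg (h n)]
  refine (ho.trans_isBigO hO).congr_left fun n => ?_
  rw [hker.integral_mul_taylorTwo_prod]
  simp only [mu1, mu2, iteratedFDeriv_two_fst hφ, iteratedDeriv_two_snd hφ]

end Kernels

/-! ### Consequences of the regression model: densities and mean square errors -/

section Model

variable {Ω : Type*} [MeasurableSpace Ω] {μ : Measure Ω} {d : ℕ}
  {X : ℕ → Ω → Cov d} {Y ε : ℕ → Ω → ℝ} {m g : Cov d → ℝ} {f : ℝ → ℝ} {φ : Cov d × ℝ → ℝ}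

theorem integral_comp_of_law {α : Type*} [MeasurableSpace α] {ν : Measure α} {U : Ω → α}
    (hU : Measurable U) {q : α → ℝ} (hq : Measurable q) (hq0 : ∀ a, 0 ≤ q a)
    (hlaw : μ.map U = ν.withDensity fun a => ENNReal.ofReal (q a)) {ψ : α → ℝ}
    (hψ : Measurable ψ) : ∫ ω, ψ (U ω) ∂μ = ∫ a, ψ a * q a ∂ν := by
  rw [← integral_map hU.aemeasurable hψ.aestronglyMeasurable, hlaw,
    integral_withDensity_eq_integral_toReal_smul hq.ennreal_ofReal
      (ae_of_all _ fun a => ENNReal.ofReal_lt_top)]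
  refine integral_congr_ae (ae_of_all _ fun a => ?_)
  simp [ENNReal.toReal_ofReal (hq0 a), mul_comm]

theorem RegressionModel.integral_X_kernel (hmodel : RegressionModel μ X Y ε m g f φ)
    {h : ℝ} (hh : 0 < h) (x : Cov d) {L q : Cov d → ℝ} (hL : Measurable L) (hq : Measurable q) :
    ∫ ω, L (h⁻¹ • (X 0 ω - x)) * q (X 0 ω) ∂μ =
      h ^ d * ∫ z, L z * (q (x + h • z) * g (x + h • z)) := by
  have hψ : Measurable fun u => L (h⁻¹ • (u - x)) * q u :=
    (hL.comp (by fun_prop)).mul hq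
  rw [integral_comp_of_law (hmodel.measurable_X 0) hmodel.measurable_g hmodel.nonneg_g
    (hmodel.law_X 0) hψ, ← integral_comp_rescale hh x L fun u => q u * g u]
  simp only [mul_assoc]

theorem RegressionModel.integral_pair_kernel (hmodel : RegressionModel μ X Y ε m g f φ)
    {h k : ℝ} (hh : 0 < h) (hk : 0 < k) (x : Cov d) (y : ℝ) {L : Cov d × ℝ → ℝ}
    (hL : Measurable L) :
    ∫ ω, L (h⁻¹ • (X 0 ω - x), (Y 0 ω - y) / k) ∂μ =
      h ^ d * k * ∫ w, L w * φ ((x, y) + (h • w.1, k * w.2)) := by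
  have hψ : Measurable fun p : Cov d × ℝ => L (h⁻¹ • (p.1 - x), (p.2 - y) / k) :=
    hL.comp (by fun_prop)
  rw [← integral_comp_rescale_prod hh hk x y hL hmodel.measurable_φ]
  exact integral_comp_of_law ((hmodel.measurable_X 0).prodMk (hmodel.measurable_Y 0))
    hmodel.measurable_φ hmodel.nonneg_φ (hmodel.law_pair 0) hψ

variable {S₀ : Set (Cov d)} {K₀ : Cov d → ℝ} {K₁ : ℝ → ℝ}

theorem Regularity.contDiffAt_g {S : Set (Cov d)} (hreg : Regularity S S₀ m g f φ) {x : Cov d}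
    (hx : x ∈ S₀) : ContDiffAt ℝ 2 g x :=
  hreg.smooth_g.contDiffAt (mem_interior_iff_mem_nhds.1 (hreg.inner_S₀ hx))

theorem Regularity.contDiffAt_m {S : Set (Cov d)} (hreg : Regularity S S₀ m g f φ) {x : Cov d}
    (hx : x ∈ S₀) : ContDiffAt ℝ 2 m x :=
  hreg.smooth_m.contDiffAt (mem_interior_iff_mem_nhds.1 (hreg.inner_S₀ hx))

theorem RegressionModel.exists_integral_kernel_sq_le (hmodel : RegressionModel μ X Y ε m g f φ)
    {S : Set (Cov d)} (hreg : Regularity S S₀ m g f φ) (hker : KernelConditions K₀ K₁)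
    {x : Cov d} (hx : x ∈ S₀) {h : ℕ → ℝ} (hpos : ∀ n, 0 < h n) (hlim : Tendsto h atTop (𝓝 0)) :
    ∃ C, 0 ≤ C ∧ ∀ᶠ n in atTop,
      ∫ ω, K₀ ((h n)⁻¹ • (X 0 ω - x)) ^ 2 ∂μ ≤ C * h n ^ d := by
  have hc : Continuous fun z => K₀ z ^ 2 := hker.continuous_K₀.pow 2
  have hs : HasCompactSupport fun z => K₀ z ^ 2 :=
    hker.hasCompactSupport.comp_left (g := fun t : ℝ => t ^ 2) (by simp)
  have ht := tendsto_integral_rescale hc hs hmodel.measurable_g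
    (hreg.contDiffAt_g hx).continuousAt hpos hlim
  refine ⟨|(∫ z, K₀ z ^ 2) * g x| + 1, by positivity, ?_⟩
  filter_upwards [ht.eventually_le_const ((le_abs_self _).trans_lt (lt_add_one _))] with n hn
  have h1 := hmodel.integral_X_kernel (hpos n) x hc.measurable (measurable_const (a := (1 : ℝ)))
  simp only [mul_one, one_mul] at h1
  rw [h1, mul_comm]
  have := hpos n
  gcongr

variable [IsProbabilityMeasure μ]

/-- The pair `(X, Y)` is the image of `(X, ε)` under the shear `(u, t) ↦ (u, m u + t)`, which
preserves Lebesgue measure for any measurable `m`; independence makes the density of `(X, ε)` a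
product. -/
theorem RegressionModel.joint_density_ae_eq (hmodel : RegressionModel μ X Y ε m g f φ) :
    φ =ᵐ[volume] fun p => g p.1 * f (p.2 - m p.1) := by
  have hX := hmodel.measurable_X 0
  have hm := hmodel.measurable_m
  have hε : AEMeasurable (ε 0) μ := (hmodel.moment_error 0).aestronglyMeasurable.aemeasurable
  have hgm := hmodel.measurable_g
  have hfm := hmodel.measurable_f
  set T : Cov d × ℝ → Cov d × ℝ := fun p => (p.1, m p.1 + p.2) with hT
  have hTp : MeasurePreserving T volume volume :=
    (MeasurePreserving.id (volume : Measure (Cov d))).skew_product (g := fun u t => m u + t)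
      (by fun_prop) (ae_of_all _ fun u => map_add_left_eq_self volume (m u))
  have hprod : μ.map (fun ω => (X 0 ω, ε 0 ω)) = volume.withDensity
      fun p : Cov d × ℝ => ENNReal.ofReal (g p.1) * ENNReal.ofReal (f p.2) := by
    rw [(indepFun_iff_map_prod_eq_prod_map_map hX.aemeasurable hε).1 (hmodel.indep_error 0),
      hmodel.law_X 0, hmodel.law_error 0,
      prod_withDensity hgm.ennreal_ofReal hfm.ennreal_ofReal]
    rfl
  have hpair : (fun ω => (X 0 ω, Y 0 ω)) = T ∘ fun ω => (X 0 ω, ε 0 ω) := by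
    ext ω : 1
    simp [hT, hmodel.model 0 ω]
  have hlaw : (volume : Measure (Cov d × ℝ)).withDensity (fun p => ENNReal.ofReal (φ p)) =
      volume.withDensity fun p => ENNReal.ofReal (g p.1 * f (p.2 - m p.1)) := by
    have hqm : Measurable fun p : Cov d × ℝ => ENNReal.ofReal (g p.1 * f (p.2 - m p.1)) := by
      fun_prop
    rw [← hmodel.law_pair 0, hpair,
      ← AEMeasurable.map_map_of_aemeasurable hTp.measurable.aemeasurable (by fun_prop), hprod]
    ext A hA
    rw [Measure.map_apply hTp.measurable hA, withDensity_apply _ (hTp.measurable hA),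
      withDensity_apply _ hA, ← hTp.setLIntegral_comp_preimage hA hqm]
    refine lintegral_congr fun p => ?_
    simp [hT, ENNReal.ofReal_mul (hmodel.nonneg_g _)]
  have hfin : ∫⁻ p, ENNReal.ofReal (φ p) ≠ ⊤ := by
    have h1 : (μ.map fun ω => (X 0 ω, Y 0 ω)) Set.univ ≠ ⊤ := measure_ne_top _ _
    rwa [hmodel.law_pair 0, withDensity_apply _ MeasurableSet.univ, Measure.restrict_univ] at h1
  have hae := (withDensity_eq_iff hmodel.measurable_φ.ennreal_ofReal.aemeasurable
    (by fun_prop) hfin).1 hlaw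
  filter_upwards [hae] with p hp
  exact (ENNReal.ofReal_eq_ofReal_iff (hmodel.nonneg_φ p)
    (mul_nonneg (hmodel.nonneg_g _) (hmodel.nonneg_f _))).1 hp

/-- Both sides of the almost everywhere identity are continuous on the open set `interior S ×ˢ
univ`, hence equal everywhere on it; `S₀` lies inside this interior. -/
theorem RegressionModel.joint_density_eq (hmodel : RegressionModel μ X Y ε m g f φ)
    {S : Set (Cov d)} (hreg : Regularity S S₀ m g f φ) {x : Cov d} (hx : x ∈ S₀) (e : ℝ) :
    φ (x, m x + e) = g x * f e := by
  have hU : IsOpen (interior S ×ˢ (Set.univ : Set ℝ)) := isOpen_interior.prod isOpen_univ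
  have hgc : ContinuousOn g (interior S) := hreg.smooth_g.continuousOn.mono interior_subset
  have hmc : ContinuousOn m (interior S) := hreg.smooth_m.continuousOn.mono interior_subset
  have hfst : Set.MapsTo Prod.fst (interior S ×ˢ (Set.univ : Set ℝ)) (interior S) :=
    fun p hp => hp.1
  have hc : ContinuousOn (fun p : Cov d × ℝ => g p.1 * f (p.2 - m p.1))
      (interior S ×ˢ (Set.univ : Set ℝ)) :=
    (hgc.comp continuousOn_fst hfst).mul (hreg.smooth_f.continuous.comp_continuousOn
      (continuousOn_snd.sub (hmc.comp continuousOn_fst hfst)))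
  have hmem : (x, m x + e) ∈ interior S ×ˢ (Set.univ : Set ℝ) :=
    ⟨hreg.inner_S₀ hx, Set.mem_univ _⟩
  simpa using Measure.eqOn_open_of_ae_eq (ae_restrict_of_ae hmodel.joint_density_ae_eq) hU
    hreg.smooth_φ.continuous.continuousOn hc hmem

/-- Mean square error of a normalized kernel sum around `θ`. -/
theorem integral_sq_average_sub_le {𝒵 : Type*} [MeasurableSpace 𝒵] {Z : ℕ → Ω → 𝒵}
    (hindep : iIndepFun Z μ) (hident : ∀ i, IdentDistrib (Z i) (Z 0) μ μ) {ψ : 𝒵 → ℝ}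
    (hψ : Measurable ψ) (hL2 : MemLp (fun ω => ψ (Z 0 ω)) 2 μ) {n : ℕ} (hn : 1 ≤ n)
    {h C₁ C₂ θ : ℝ} (hh : 0 < h) (hsq : ∫ ω, ψ (Z 0 ω) ^ 2 ∂μ ≤ C₁ * h ^ d)
    (hbias : |(∫ ω, ψ (Z 0 ω) ∂μ) / h ^ d - θ| ≤ C₂ * h ^ 2) :
    ∫ ω, (1 / ((n : ℝ) * h ^ d) * ∑ i ∈ Finset.range n, ψ (Z i ω) - θ) ^ 2 ∂μ ≤
      (C₁ + C₂ ^ 2) * (h ^ 4 + 1 / ((n : ℝ) * h ^ d)) := by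
  have hn0 : (0 : ℝ) < n := by exact_mod_cast hn
  set N := (n : ℝ) * h ^ d with hN
  have hN0 : 0 < N := by positivity
  have hC₁ : 0 ≤ C₁ := by
    have h1 : 0 ≤ C₁ * h ^ d := (integral_nonneg fun ω => sq_nonneg _).trans hsq
    exact nonneg_of_mul_nonneg_left h1 (by positivity)
  obtain ⟨-, hle⟩ := integral_sq_sum_sub_le hindep hident hψ hL2 n (N * θ)
  have e1 : ∀ ω, (1 / N * ∑ i ∈ Finset.range n, ψ (Z i ω) - θ) ^ 2 =
      (1 / N ^ 2) * (∑ i ∈ Finset.range n, ψ (Z i ω) - N * θ) ^ 2 := fun ω => by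
    field_simp
  simp_rw [e1]
  rw [integral_const_mul]
  have e2 : n * (∫ ω, ψ (Z 0 ω) ∂μ) - N * θ = N * ((∫ ω, ψ (Z 0 ω) ∂μ) / h ^ d - θ) := by
    rw [hN]
    field_simp
  have h3 : ((∫ ω, ψ (Z 0 ω) ∂μ) / h ^ d - θ) ^ 2 ≤ (C₂ * h ^ 2) ^ 2 := by
    rw [← sq_abs]
    gcongr
  calc 1 / N ^ 2 * ∫ ω, (∑ i ∈ Finset.range n, ψ (Z i ω) - N * θ) ^ 2 ∂μ
      ≤ 1 / N ^ 2 * (n * (C₁ * h ^ d) + N ^ 2 * (C₂ * h ^ 2) ^ 2) := by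
        gcongr
        refine hle.trans ?_
        rw [e2, mul_pow]
        gcongr
    _ = C₁ * (1 / N) + C₂ ^ 2 * h ^ 4 := by
        rw [hN]
        field_simp
    _ ≤ (C₁ + C₂ ^ 2) * (h ^ 4 + 1 / N) := by
        have i1 : 0 ≤ C₁ * h ^ 4 := by positivity
        have i2 : 0 ≤ C₂ ^ 2 * (1 / N) := by positivity
        linarith

/-- Mean square error of the kernel estimator of the density of the covariate. -/
theorem RegressionModel.exists_density_mse_le (hmodel : RegressionModel μ X Y ε m g f φ)
    {S : Set (Cov d)} (hreg : Regularity S S₀ m g f φ) (hker : KernelConditions K₀ K₁)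
    {x : Cov d} (hx : x ∈ S₀) {h : ℕ → ℝ} (hpos : ∀ n, 0 < h n) (hlim : Tendsto h atTop (𝓝 0)) :
    (∀ n : ℕ, Integrable (fun ω => (1 / ((n : ℝ) * h n ^ d) * ∑ i ∈ Finset.range n,
      K₀ ((h n)⁻¹ • (X i ω - x)) - g x) ^ 2) μ) ∧
    ∃ C, 0 ≤ C ∧ ∀ᶠ n : ℕ in atTop,
      ∫ ω, (1 / ((n : ℝ) * h n ^ d) * ∑ i ∈ Finset.range n,
        K₀ ((h n)⁻¹ • (X i ω - x)) - g x) ^ 2 ∂μ ≤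
        C * (h n ^ 4 + 1 / ((n : ℝ) * h n ^ d)) := by
  obtain ⟨B, hB⟩ := hker.hasCompactSupport.exists_bound_of_continuous hker.continuous_K₀
  set ψ : ℕ → Cov d × ℝ → ℝ := fun n p => K₀ ((h n)⁻¹ • (p.1 - x))
  have hψ : ∀ n, Measurable (ψ n) := fun n => hker.continuous_K₀.measurable.comp (by fun_prop)
  have hXY : ∀ i, Measurable fun ω => (X i ω, Y i ω) := fun i =>
    (hmodel.measurable_X i).prodMk (hmodel.measurable_Y i)
  have hb : ∀ n i, MemLp (fun ω => ψ n (X i ω, Y i ω)) 2 μ := fun n i =>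
    MemLp.of_bound ((hψ n).comp (hXY i)).aestronglyMeasurable B (ae_of_all _ fun ω => hB _)
  constructor
  · intro n
    have h1 : MemLp (fun ω => ∑ i ∈ Finset.range n, ψ n (X i ω, Y i ω)) 2 μ :=
      memLp_finsetSum _ fun i _ => hb n i
    exact ((h1.const_mul (1 / ((n : ℝ) * h n ^ d))).sub (memLp_const (g x))).integrable_sq
  · obtain ⟨C₁, hC₁, h1⟩ := hmodel.exists_integral_kernel_sq_le hreg hker hx hpos hlim
    obtain ⟨C₂, -, h2⟩ := hker.exists_bias_le hmodel.measurable_g (hreg.contDiffAt_g hx) hpos hlim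
    refine ⟨C₁ + C₂ ^ 2, by positivity, ?_⟩
    filter_upwards [h1, h2, eventually_ge_atTop 1] with n hn1 hn2 hn
    refine integral_sq_average_sub_le (ψ := ψ n) hmodel.indep_pairs hmodel.ident_pairs (hψ n)
      (hb n 0) hn (hpos n) hn1 ?_
    have h3 := hmodel.integral_X_kernel (hpos n) x hker.continuous_K₀.measurable
      (measurable_const (a := (1 : ℝ)))
    simp only [mul_one, one_mul] at h3
    have hne : h n ^ d ≠ 0 := (pow_pos (hpos n) d).ne'
    simp only [ψ]
    rwa [h3, mul_div_cancel_left₀ _ hne]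

/-- Mean square of the centered numerator of the Nadaraya–Watson estimator. -/
theorem RegressionModel.exists_regression_mse_le (hmodel : RegressionModel μ X Y ε m g f φ)
    (hreg : Regularity (μ.map (X 0)).support S₀ m g f φ) (hker : KernelConditions K₀ K₁)
    {x : Cov d} (hx : x ∈ S₀) {h : ℕ → ℝ} (hpos : ∀ n, 0 < h n) (hlim : Tendsto h atTop (𝓝 0)) :
    (∀ n : ℕ, Integrable (fun ω => (1 / ((n : ℝ) * h n ^ d) * ∑ i ∈ Finset.range n,
      (Y i ω - m x) * K₀ ((h n)⁻¹ • (X i ω - x))) ^ 2) μ) ∧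
    ∃ C, 0 ≤ C ∧ ∀ᶠ n : ℕ in atTop,
      ∫ ω, (1 / ((n : ℝ) * h n ^ d) * ∑ i ∈ Finset.range n,
        (Y i ω - m x) * K₀ ((h n)⁻¹ • (X i ω - x))) ^ 2 ∂μ ≤
        C * (h n ^ 4 + 1 / ((n : ℝ) * h n ^ d)) := by
  obtain ⟨B, hB⟩ := hker.hasCompactSupport.exists_bound_of_continuous hker.continuous_K₀
  have hmm := hmodel.measurable_m
  have hX0 := hmodel.measurable_X 0
  set κ : ℕ → Ω → ℝ := fun n ω => K₀ ((h n)⁻¹ • (X 0 ω - x)) with hκ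
  set ψ : ℕ → Cov d × ℝ → ℝ := fun n p => (p.2 - m x) * K₀ ((h n)⁻¹ • (p.1 - x)) with hψdef
  have hKm : ∀ n, Measurable fun u : Cov d => K₀ ((h n)⁻¹ • (u - x)) := fun n =>
    hker.continuous_K₀.measurable.comp (by fun_prop)
  have hψ : ∀ n, Measurable (ψ n) := fun n =>
    (measurable_snd.sub_const _).mul ((hKm n).comp measurable_fst)
  have hκm : ∀ n, Measurable (κ n) := fun n => (hKm n).comp hX0
  have hκb : ∀ n ω, ‖κ n ω‖ ≤ B := fun n ω => hB _
  -- The covariate almost surely lies in its support, which is compact, and `m` is continuous there.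
  obtain ⟨M, hM0, hM⟩ : ∃ M, 0 ≤ M ∧ ∀ᵐ ω ∂μ, |m (X 0 ω) - m x| ≤ M := by
    obtain ⟨M, hM⟩ := hreg.compact_S.exists_bound_of_continuousOn
      (hreg.smooth_m.continuousOn.sub (continuousOn_const (c := m x)))
    refine ⟨|M|, abs_nonneg _, ?_⟩
    have h1 : ∀ᵐ u ∂(μ.map (X 0)), u ∈ (μ.map (X 0)).support := Measure.support_mem_ae
    filter_upwards [ae_of_ae_map hX0.aemeasurable h1] with ω hω
    exact (hM _ hω).trans (le_abs_self M)
  have hε2 : MemLp (ε 0) 2 μ := (hmodel.moment_error 0).mono_exponent (by norm_num)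
  have hdm : Measurable fun ω => m (X 0 ω) - m x := (hmm.comp hX0).sub_const _
  have hdL : MemLp (fun ω => m (X 0 ω) - m x) 2 μ :=
    MemLp.of_bound hdm.aestronglyMeasurable M hM
  have hYd : ∀ ω, Y 0 ω - m x = (m (X 0 ω) - m x) + ε 0 ω := fun ω => by
    rw [hmodel.model 0 ω]; ring
  have hY2 : MemLp (fun ω => Y 0 ω - m x) 2 μ := by
    simp_rw [hYd]
    exact hdL.add hε2
  have hL0 : ∀ n, MemLp (fun ω => ψ n (X 0 ω, Y 0 ω)) 2 μ := fun n => by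
    refine hY2.of_le_mul (c := B)
      ((hψ n).comp (hX0.prodMk (hmodel.measurable_Y 0))).aestronglyMeasurable
      (ae_of_all _ fun ω => ?_)
    simp only [hψdef, norm_mul]
    rw [mul_comm]
    gcongr
    exact hκb n ω
  have hb : ∀ n i, MemLp (fun ω => ψ n (X i ω, Y i ω)) 2 μ := fun n i =>
    ((hmodel.ident_pairs i).comp (hψ n)).symm.memLp_snd (hL0 n)
  constructor
  · intro n
    have h1 : MemLp (fun ω => ∑ i ∈ Finset.range n, ψ n (X i ω, Y i ω)) 2 μ :=
      memLp_finsetSum _ fun i _ => hb n i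
    exact (h1.const_mul (1 / ((n : ℝ) * h n ^ d))).integrable_sq
  · set V := ∫ ω, ε 0 ω ^ 2 ∂μ
    have hV : 0 ≤ V := integral_nonneg fun ω => sq_nonneg _
    obtain ⟨C₁, hC₁, h1⟩ := hmodel.exists_integral_kernel_sq_le hreg hker hx hpos hlim
    have hFm : Measurable fun u => (m u - m x) * g u := (hmm.sub_const _).mul hmodel.measurable_g
    -- The smoothed function `(m - m x) g` vanishes at `x`, so the quadratic bias bound applies with
    -- target `0`; the error term has mean zero and contributes no bias.
    obtain ⟨C₂, -, h2⟩ := hker.exists_bias_le hFm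
      (((hreg.contDiffAt_m hx).sub contDiffAt_const).mul (hreg.contDiffAt_g hx)) hpos hlim
    refine ⟨(2 * M ^ 2 + 2 * V) * C₁ + C₂ ^ 2, by positivity, ?_⟩
    filter_upwards [h1, h2, eventually_ge_atTop 1] with n hn1 hn2 hn
    have hindκ : IndepFun (κ n) (ε 0) μ :=
      (hmodel.indep_error 0).comp (hKm n) measurable_id
    have hκi : Integrable (κ n) μ :=
      Integrable.of_bound (hκm n).aestronglyMeasurable B (ae_of_all _ (hκb n))
    have hκ2 : Integrable (fun ω => κ n ω ^ 2) μ :=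
      (MemLp.of_bound (p := 2) (hκm n).aestronglyMeasurable B (ae_of_all _ (hκb n))).integrable_sq
    have hεκ : ∫ ω, κ n ω ^ 2 * ε 0 ω ^ 2 ∂μ = (∫ ω, κ n ω ^ 2 ∂μ) * V :=
      (hindκ.comp (φ := fun t : ℝ => t ^ 2) (ψ := fun t : ℝ => t ^ 2) (by fun_prop)
        (by fun_prop)).integral_fun_mul_eq_mul_integral hκ2.aestronglyMeasurable
        hε2.integrable_sq.aestronglyMeasurable
    have hεκi : Integrable (fun ω => κ n ω ^ 2 * ε 0 ω ^ 2) μ :=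
      (hindκ.comp (φ := fun t : ℝ => t ^ 2) (ψ := fun t : ℝ => t ^ 2) (by fun_prop)
        (by fun_prop)).integrable_mul hκ2 hε2.integrable_sq
    have key := integral_sq_average_sub_le (ψ := ψ n) (h := h n) (θ := 0) (C₂ := C₂)
      (C₁ := (2 * M ^ 2 + 2 * V) * C₁) (d := d) hmodel.indep_pairs hmodel.ident_pairs
      (hψ n) (hb n 0) hn (hpos n) ?_ ?_
    · simpa only [sub_zero] using key
    · have hle : ∀ᵐ ω ∂μ, ψ n (X 0 ω, Y 0 ω) ^ 2 ≤
          2 * M ^ 2 * κ n ω ^ 2 + 2 * (κ n ω ^ 2 * ε 0 ω ^ 2) := by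
        filter_upwards [hM] with ω hω
        have e1 : ψ n (X 0 ω, Y 0 ω) = ((m (X 0 ω) - m x) + ε 0 ω) * κ n ω := by
          simp only [hψdef, hκ, hYd]
        have e2 : (m (X 0 ω) - m x) ^ 2 ≤ M ^ 2 := by
          rw [← sq_abs]
          gcongr
        have e3 : ((m (X 0 ω) - m x) + ε 0 ω) ^ 2 ≤ 2 * M ^ 2 + 2 * ε 0 ω ^ 2 := by
          nlinarith [sq_nonneg ((m (X 0 ω) - m x) - ε 0 ω)]
        rw [e1, mul_pow]
        nlinarith [mul_le_mul_of_nonneg_right e3 (sq_nonneg (κ n ω))]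
      calc ∫ ω, ψ n (X 0 ω, Y 0 ω) ^ 2 ∂μ
          ≤ ∫ ω, (2 * M ^ 2 * κ n ω ^ 2 + 2 * (κ n ω ^ 2 * ε 0 ω ^ 2)) ∂μ :=
            integral_mono_ae (hb n 0).integrable_sq
              ((hκ2.const_mul _).add (hεκi.const_mul _)) hle
        _ = (2 * M ^ 2 + 2 * V) * ∫ ω, κ n ω ^ 2 ∂μ := by
            rw [integral_add (hκ2.const_mul _) (hεκi.const_mul _), integral_const_mul,
              integral_const_mul, hεκ]
            ring
        _ ≤ (2 * M ^ 2 + 2 * V) * (C₁ * h n ^ d) := by gcongr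
        _ = _ := by ring
    · have h3 := hmodel.integral_X_kernel (hpos n) x hker.continuous_K₀.measurable
        (q := fun u => m u - m x) (hmm.sub_const _)
      have h4 : ∫ ω, κ n ω * ε 0 ω ∂μ = 0 := by
        rw [hindκ.integral_fun_mul_eq_mul_integral hκi.aestronglyMeasurable
          hε2.aestronglyMeasurable, hmodel.centered_error 0, mul_zero]
      have h5 : ∫ ω, ψ n (X 0 ω, Y 0 ω) ∂μ =
          ∫ ω, κ n ω * (m (X 0 ω) - m x) ∂μ + ∫ ω, κ n ω * ε 0 ω ∂μ := by
        rw [← integral_add]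
        · refine integral_congr_ae (ae_of_all _ fun ω => ?_)
          simp only [hψdef, hκ, hYd]
          ring
        · exact (hdL.integrable (by norm_num)).bdd_mul (hκm n).aestronglyMeasurable
            (ae_of_all _ (hκb n))
        · exact (hε2.integrable (by norm_num)).bdd_mul (hκm n).aestronglyMeasurable
            (ae_of_all _ (hκb n))
      have hne : h n ^ d ≠ 0 := (pow_pos (hpos n) d).ne'
      rw [h5, h4, add_zero, h3, mul_div_cancel_left₀ _ hne]
      simpa using hn2

end Model

/-! ### Consequences of the bandwidth conditions -/

section Bandwidths

variable {d : ℕ} {b₀ h₀ h₁ : ℕ → ℝ}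

/-- Since `1 ≤ log n` for `n ≥ 3`, the logarithm may be dropped: a pointwise rate is enough here. -/
theorem BandwidthConditions.tendsto_pilot_rate (hband : BandwidthConditions d b₀ h₀ h₁) :
    Tendsto (fun n : ℕ => ((n : ℝ) * h₀ n ^ d / h₁ n) *
      (b₀ n ^ 4 + 1 / ((n : ℝ) * b₀ n ^ d))) atTop (𝓝 0) := by
  refine squeeze_zero' (Eventually.of_forall fun n => ?_) ?_ hband.small_pilot
  · have := hband.pos_b₀ n; have := hband.pos_h₀ n; have := hband.pos_h₁ n
    positivity
  · filter_upwards [eventually_ge_atTop 3] with n hn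
    have := hband.pos_b₀ n; have := hband.pos_h₀ n; have := hband.pos_h₁ n
    have hlog : 1 ≤ Real.log n := by
      rw [Real.le_log_iff_exp_le (by positivity)]
      have h3 : (3 : ℝ) ≤ n := by exact_mod_cast hn
      linarith [Real.exp_one_lt_d9]
    gcongr

theorem BandwidthConditions.tendsto_pilot_mse (hband : BandwidthConditions d b₀ h₀ h₁) :
    Tendsto (fun n : ℕ => b₀ n ^ 4 + 1 / ((n : ℝ) * b₀ n ^ d)) atTop (𝓝 0) := by
  have h1 : Tendsto (fun n : ℕ => h₁ n ^ 2 * ((n : ℝ) * h₀ n ^ d * h₁ n)⁻¹) atTop (𝓝 0) := by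
    simpa using (hband.tendsto_h₁.pow 2).mul (tendsto_inv_atTop_zero.comp hband.large_h₀_h₁)
  have h2 := h1.mul hband.tendsto_pilot_rate
  rw [zero_mul] at h2
  refine h2.congr' ?_
  filter_upwards [eventually_ge_atTop 1] with n hn
  have hn0 : (0 : ℝ) < n := by exact_mod_cast hn
  have := hband.pos_b₀ n; have := hband.pos_h₀ n; have := hband.pos_h₁ n
  field_simp

/-- The bandwidth conditions force undersmoothing in the direction of the covariate. -/
theorem BandwidthConditions.tendsto_undersmoothing (hd : 1 ≤ d)
    (hband : BandwidthConditions d b₀ h₀ h₁) :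
    Tendsto (fun n : ℕ => ((n : ℝ) * h₀ n ^ d * h₁ n) *
      (h₀ n ^ 4 + 1 / ((n : ℝ) * h₀ n ^ d))) atTop (𝓝 0) := by
  have hlim := hband.tendsto_pilot_rate.add hband.tendsto_h₁
  rw [add_zero] at hlim
  refine squeeze_zero' (Eventually.of_forall fun n => ?_) ?_ hlim
  · have := hband.pos_h₀ n; have := hband.pos_h₁ n
    positivity
  · filter_upwards [eventually_ge_atTop 1, hband.tendsto_pilot_rate.eventually_le_const one_pos,
      hband.tendsto_h₁.eventually_le_const one_pos] with n hn hrate hh₁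
    have hn0 : (0 : ℝ) < n := by exact_mod_cast hn
    have pb := hband.pos_b₀ n
    have p0 := hband.pos_h₀ n
    have p1 := hband.pos_h₁ n
    -- The part of the pilot rate coming from `1 / (n b₀^d)` is `h₀^d / (h₁ b₀^d)`. Once it and `h₁`
    -- are at most `1`, `h₀^d ≤ b₀^d`; taking roots needs `d ≥ 1`.
    have hle : h₀ n ≤ b₀ n := by
      have e1 : (n : ℝ) * h₀ n ^ d / h₁ n * (1 / ((n : ℝ) * b₀ n ^ d)) ≤ 1 := by
        refine le_trans ?_ hrate
        gcongr
        exact le_add_of_nonneg_left (by positivity)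
      have e2 : (n : ℝ) * h₀ n ^ d / h₁ n * (1 / ((n : ℝ) * b₀ n ^ d)) =
          h₀ n ^ d / (h₁ n * b₀ n ^ d) := by field_simp
      rw [e2, div_le_one (by positivity)] at e1
      have e3 : h₀ n ^ d ≤ b₀ n ^ d := e1.trans (mul_le_of_le_one_left (by positivity) hh₁)
      exact le_of_pow_le_pow_left₀ (by omega) pb.le e3
    rw [mul_add]
    refine add_le_add ?_ (le_of_eq (by field_simp))
    calc (n : ℝ) * h₀ n ^ d * h₁ n * h₀ n ^ 4
        = (n : ℝ) * h₀ n ^ d / h₁ n * (h₁ n ^ 2 * h₀ n ^ 4) := by field_simp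
      _ ≤ (n : ℝ) * h₀ n ^ d / h₁ n * (1 ^ 2 * b₀ n ^ 4) := by gcongr
      _ ≤ (n : ℝ) * h₀ n ^ d / h₁ n * (b₀ n ^ 4 + 1 / ((n : ℝ) * b₀ n ^ d)) := by
          gcongr
          rw [one_pow, one_mul]
          exact le_add_of_nonneg_right (by positivity)

theorem BandwidthConditions.tendsto_density_mse (hd : 1 ≤ d)
    (hband : BandwidthConditions d b₀ h₀ h₁) :
    Tendsto (fun n : ℕ => h₀ n ^ 4 + 1 / ((n : ℝ) * h₀ n ^ d)) atTop (𝓝 0) := by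
  have h2 := (tendsto_inv_atTop_zero.comp hband.large_h₀_h₁).mul (hband.tendsto_undersmoothing hd)
  rw [zero_mul] at h2
  refine h2.congr' ?_
  filter_upwards [eventually_ge_atTop 1] with n hn
  have hn0 : (0 : ℝ) < n := by exact_mod_cast hn
  have := hband.pos_h₀ n; have := hband.pos_h₁ n
  simp only [Function.comp_apply]
  rw [inv_mul_cancel_left₀ (by positivity)]

end Bandwidths

/-! ### The three terms of the decomposition -/

section Asymptotics

variable {Ω : Type*} [MeasurableSpace Ω] {μ : Measure Ω} [IsProbabilityMeasure μ] {d : ℕ}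
  {X : ℕ → Ω → Cov d} {Y ε : ℕ → Ω → ℝ} {m g : Cov d → ℝ} {f : ℝ → ℝ} {φ : Cov d × ℝ → ℝ}
  {S₀ : Set (Cov d)} {K₀ : Cov d → ℝ} {K₁ : ℝ → ℝ} {b₀ h₀ h₁ : ℕ → ℝ} {x : Cov d}

/-- The kernel estimator of the density of the covariate is consistent. -/
theorem RegressionModel.tendstoInMeasure_density (hmodel : RegressionModel μ X Y ε m g f φ)
    {S : Set (Cov d)} (hreg : Regularity S S₀ m g f φ) (hker : KernelConditions K₀ K₁)
    (hx : x ∈ S₀) {h : ℕ → ℝ} (hpos : ∀ n, 0 < h n) (hlim : Tendsto h atTop (𝓝 0))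
    (hmse : Tendsto (fun n : ℕ => h n ^ 4 + 1 / ((n : ℝ) * h n ^ d)) atTop (𝓝 0)) :
    TendstoInMeasure μ (fun (n : ℕ) ω => 1 / ((n : ℝ) * h n ^ d) * ∑ i ∈ Finset.range n,
      K₀ ((h n)⁻¹ • (X i ω - x))) atTop fun _ => g x := by
  obtain ⟨hint, C, -, hC⟩ := hmodel.exists_density_mse_le hreg hker hx hpos hlim
  refine tendstoInMeasure_of_tendsto_integral_sq hint ?_
  refine squeeze_zero' (Eventually.of_forall fun n => integral_nonneg fun ω => sq_nonneg _) hC ?_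
  simpa using hmse.const_mul C

theorem nadarayaWatson_sub_eq {b : ℝ} (hb : 0 < b) {n : ℕ} (hn : 1 ≤ n) {xs : ℕ → Cov d}
    {ys : ℕ → ℝ} (θ : ℝ)
    (hne : 1 / ((n : ℝ) * b ^ d) * ∑ j ∈ Finset.range n, K₀ (b⁻¹ • (xs j - x)) ≠ 0) :
    nadarayaWatson K₀ b n xs ys x - θ =
      (1 / ((n : ℝ) * b ^ d) * ∑ j ∈ Finset.range n, (ys j - θ) * K₀ (b⁻¹ • (xs j - x))) /
        (1 / ((n : ℝ) * b ^ d) * ∑ j ∈ Finset.range n, K₀ (b⁻¹ • (xs j - x))) := by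
  have hn0 : (0 : ℝ) < n := by exact_mod_cast hn
  have hD := right_ne_zero_of_mul hne
  rw [mul_div_mul_left _ _ (by positivity), nadarayaWatson, div_sub' hD]
  congr 1
  simp only [sub_mul, Finset.sum_sub_distrib, mul_comm θ, Finset.sum_mul]

/-- The error of the pilot regression estimator is negligible at the scale of the naive
estimator. -/
theorem RegressionModel.tendstoInMeasure_pilot (hmodel : RegressionModel μ X Y ε m g f φ)
    (hreg : Regularity (μ.map (X 0)).support S₀ m g f φ) (hker : KernelConditions K₀ K₁)
    (hband : BandwidthConditions d b₀ h₀ h₁) (hx : x ∈ S₀) :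
    TendstoInMeasure μ (fun (n : ℕ) ω => √((n : ℝ) * h₀ n ^ d * h₁ n) / h₁ n *
      (nadarayaWatson K₀ (b₀ n) n (fun i => X i ω) (fun i => Y i ω) x - m x)) atTop
      fun _ => 0 := by
  set s : ℕ → ℝ := fun n => √((n : ℝ) * h₀ n ^ d * h₁ n) / h₁ n
  -- The squared scale is exactly the factor in front of the pilot rate in the bandwidth condition.
  have hs2 : ∀ n, s n ^ 2 = (n : ℝ) * h₀ n ^ d / h₁ n := fun n => by
    have := hband.pos_h₀ n
    have := hband.pos_h₁ n
    rw [div_pow, Real.sq_sqrt (by positivity)]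
    field_simp
  have hD := hmodel.tendstoInMeasure_density hreg hker hx hband.pos_b₀ hband.tendsto_b₀
    hband.tendsto_pilot_mse
  obtain ⟨hint, C, -, hC⟩ := hmodel.exists_regression_mse_le hreg hker hx hband.pos_b₀
    hband.tendsto_b₀
  have hU : TendstoInMeasure μ (fun (n : ℕ) ω => s n * (1 / ((n : ℝ) * b₀ n ^ d) *
      ∑ i ∈ Finset.range n, (Y i ω - m x) * K₀ ((b₀ n)⁻¹ • (X i ω - x)))) atTop fun _ => 0 := by
    refine tendstoInMeasure_of_tendsto_integral_sq (fun n => ?_) ?_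
    · simp only [sub_zero, mul_pow (s n)]
      exact (hint n).const_mul _
    · simp only [sub_zero, mul_pow (s _), integral_const_mul]
      refine squeeze_zero' (Eventually.of_forall fun n => ?_) (g := fun n : ℕ => C *
        ((n : ℝ) * h₀ n ^ d / h₁ n * (b₀ n ^ 4 + 1 / ((n : ℝ) * b₀ n ^ d)))) ?_ ?_
      · exact mul_nonneg (sq_nonneg _) (integral_nonneg fun ω => sq_nonneg _)
      · filter_upwards [hC] with n hn
        rw [hs2, mul_left_comm]
        have := hband.pos_h₀ n
        have := hband.pos_h₁ n
        gcongr
      · simpa using hband.tendsto_pilot_rate.const_mul C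
  have hg := hreg.pos_g x hx
  have hdiv : ContinuousAt (fun p : ℝ × ℝ => p.1 / p.2) (0, g x) :=
    continuousAt_fst.div continuousAt_snd hg.ne'
  have hq := tendstoInMeasure_continuousAt_comp hdiv (tendstoInMeasure_prodMk hU hD)
  simp only [zero_div] at hq
  -- The quotient formula for the pilot error is available only where the denominator is nonzero, an
  -- event whose probability tends to one.
  refine tendstoInMeasure_of_eq_on_event (isOpen_ne.mem_nhds hg.ne') hD hq ?_
  filter_upwards [eventually_ge_atTop 1] with n hn ω hω
  rw [nadarayaWatson_sub_eq (hband.pos_b₀ n) hn (m x) hω, mul_div_assoc]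

/-- Asymptotic normality of the smoothed numerator. -/
theorem RegressionModel.tendstoInDistribution_numerator (hmodel : RegressionModel μ X Y ε m g f φ)
    (hker : KernelConditions K₀ K₁) (hband : BandwidthConditions d b₀ h₀ h₁) (x : Cov d) (y : ℝ)
    (hφ : Continuous φ) :
    TendstoInDistribution (fun (n : ℕ) ω => (√((n : ℝ) * h₀ n ^ d * h₁ n))⁻¹ *
      (∑ i ∈ Finset.range n, K₀ ((h₀ n)⁻¹ • (X i ω - x)) * K₁ ((Y i ω - y) / h₁ n) -
        (n : ℝ) * h₀ n ^ d * h₁ n *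
          ∫ w : Cov d × ℝ, K₀ w.1 * K₁ w.2 * φ ((x, y) + (h₀ n • w.1, h₁ n * w.2)))) atTop
      (id : ℝ → ℝ) (fun _ => μ)
      (gaussianReal 0
        ((∫ w : Cov d × ℝ, (K₀ w.1 * K₁ w.2) ^ 2) * φ (x, y)).toNNReal) := by
  set N : ℕ → ℝ := fun n => (n : ℝ) * h₀ n ^ d * h₁ n with hN
  set L : Cov d × ℝ → ℝ := fun w => K₀ w.1 * K₁ w.2 with hL
  have hLc : Continuous L :=
    (hker.continuous_K₀.comp continuous_fst).mul (hker.smooth_K₁.continuous.comp continuous_snd)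
  have hLs : HasCompactSupport L := hasCompactSupport_mul_prod hker.hasCompactSupport
    hker.compact_K₁
  have hL2c : Continuous fun w => L w ^ 2 := hLc.pow 2
  have hL2s : HasCompactSupport fun w => L w ^ 2 :=
    hLs.comp_left (g := fun t : ℝ => t ^ 2) (by simp)
  obtain ⟨B, hB⟩ := hLs.exists_bound_of_continuous hLc
  have hXY : ∀ i, Measurable fun ω => (X i ω, Y i ω) := fun i =>
    (hmodel.measurable_X i).prodMk (hmodel.measurable_Y i)
  set a : ℕ → ℝ := fun n => ∫ w, L w * φ ((x, y) + (h₀ n • w.1, h₁ n * w.2)) with ha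
  have haE : ∀ n, ∫ ω, L ((h₀ n)⁻¹ • (X 0 ω - x), (Y 0 ω - y) / h₁ n) ∂μ =
      h₀ n ^ d * h₁ n * a n := fun n =>
    hmodel.integral_pair_kernel (hband.pos_h₀ n) (hband.pos_h₁ n) x y hLc.measurable
  have halim : Tendsto a atTop (𝓝 ((∫ w, L w) * φ (x, y))) :=
    tendsto_integral_rescale_prod hLc hLs hφ.measurable hφ.continuousAt hband.pos_h₀ hband.pos_h₁
      hband.tendsto_h₀ hband.tendsto_h₁
  have ha2lim := tendsto_integral_rescale_prod (p := (x, y)) hL2c hL2s hφ.measurable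
    hφ.continuousAt hband.pos_h₀ hband.pos_h₁ hband.tendsto_h₀ hband.tendsto_h₁
  set E : ℕ → ℝ := fun n => h₀ n ^ d * h₁ n * a n with hE
  set κ : ℕ → Cov d × ℝ → ℝ := fun n p => L ((h₀ n)⁻¹ • (p.1 - x), (p.2 - y) / h₁ n) with hκ
  have hκm : ∀ n, Measurable (κ n) := fun n => hLc.measurable.comp (by fun_prop)
  have hκi : ∀ n, Integrable (fun ω => κ n (X 0 ω, Y 0 ω)) μ := fun n =>
    Integrable.of_bound ((hκm n).comp (hXY 0)).aestronglyMeasurable B (ae_of_all _ fun ω => hB _)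
  have hκsq : ∀ n, Integrable (fun ω => κ n (X 0 ω, Y 0 ω) ^ 2) μ := fun n =>
    (MemLp.of_bound (p := 2) ((hκm n).comp (hXY 0)).aestronglyMeasurable B
      (ae_of_all _ fun ω => hB _)).integrable_sq
  have hEb : ∀ n, |E n| ≤ B := fun n => by
    rw [show E n = _ from (haE n).symm]
    simpa using norm_integral_le_of_norm_le_const (μ := μ)
      (f := fun ω => κ n (X 0 ω, Y 0 ω)) (C := B) (ae_of_all _ fun ω => hB _)
  set ψ : ℕ → Cov d × ℝ → ℝ := fun n p => (√(N n))⁻¹ * (κ n p - E n) with hψ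
  have hψm : ∀ n, Measurable (ψ n) := fun n => ((hκm n).sub_const _).const_mul _
  have hsqrt : Tendsto (fun n => √(N n)) atTop atTop :=
    Real.tendsto_sqrt_atTop.comp hband.large_h₀_h₁
  have hc : Tendsto (fun n => (√(N n))⁻¹ * (B + B)) atTop (𝓝 0) := by
    simpa using (tendsto_inv_atTop_zero.comp hsqrt).mul_const (B + B)
  have hψb : ∀ n p, |ψ n p| ≤ (√(N n))⁻¹ * (B + B) := fun n p => by
    rw [hψ, abs_mul, abs_of_nonneg (inv_nonneg.2 (Real.sqrt_nonneg _))]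
    gcongr
    exact (abs_sub _ _).trans (add_le_add (hB _) (hEb n))
  have hψ0 : ∀ n, ∫ ω, ψ n (X 0 ω, Y 0 ω) ∂μ = 0 := fun n => by
    simp only [hψ]
    rw [integral_const_mul, integral_sub (hκi n) (integrable_const _)]
    simp only [hκ]
    rw [haE n]
    simp [hE]
  have hv : 0 ≤ (∫ w, L w ^ 2) * φ (x, y) :=
    mul_nonneg (integral_nonneg fun w => sq_nonneg _) (hmodel.nonneg_φ _)
  have hvar : Tendsto (fun n : ℕ => n * ∫ ω, ψ n (X 0 ω, Y 0 ω) ^ 2 ∂μ) atTop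
      (𝓝 ((∫ w, L w ^ 2) * φ (x, y))) := by
    -- After rescaling, `n E[ψ²]` is the smoothed second moment minus the squared mean; the latter
    -- carries `h₀^d h₁ → 0` and does not affect the limit variance.
    have hlim : Tendsto (fun n => (∫ w, L w ^ 2 * φ ((x, y) + (h₀ n • w.1, h₁ n * w.2))) -
        h₀ n ^ d * h₁ n * a n ^ 2) atTop
        (𝓝 ((∫ w, L w ^ 2) * φ (x, y) - 0 ^ d * 0 * ((∫ w, L w) * φ (x, y)) ^ 2)) :=
      ha2lim.sub (((hband.tendsto_h₀.pow d).mul hband.tendsto_h₁).mul (halim.pow 2))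
    rw [mul_zero, zero_mul, sub_zero] at hlim
    refine hlim.congr' ?_
    filter_upwards [eventually_ge_atTop 1] with n hn
    have hn0 : (0 : ℝ) < n := by exact_mod_cast hn
    have p0 := hband.pos_h₀ n
    have p1 := hband.pos_h₁ n
    have hN0 : 0 < N n := by positivity
    have e1 : ∀ ω, ψ n (X 0 ω, Y 0 ω) ^ 2 = (N n)⁻¹ *
        (κ n (X 0 ω, Y 0 ω) ^ 2 + (-(2 * E n)) * κ n (X 0 ω, Y 0 ω) + E n ^ 2) := fun ω => by
      simp only [hψ]
      rw [mul_pow, inv_pow, Real.sq_sqrt hN0.le]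
      ring
    have e2 : ∫ ω, κ n (X 0 ω, Y 0 ω) ∂μ = E n := haE n
    have e3 : ∫ ω, κ n (X 0 ω, Y 0 ω) ^ 2 ∂μ = h₀ n ^ d * h₁ n *
        ∫ w, L w ^ 2 * φ ((x, y) + (h₀ n • w.1, h₁ n * w.2)) :=
      hmodel.integral_pair_kernel p0 p1 x y hL2c.measurable
    simp_rw [e1]
    rw [integral_const_mul, (integral_add_eq (integral_add_eq ⟨hκsq n, rfl⟩
      ⟨(hκi n).const_mul (-(2 * E n)), rfl⟩) ⟨integrable_const (E n ^ 2), rfl⟩).2,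
      integral_const_mul, e2, e3]
    simp only [integral_const, probReal_univ, smul_eq_mul, one_mul, hE, hN]
    field_simp
    ring
  have hclt := tendstoInDistribution_sum_of_bounded hmodel.indep_pairs hmodel.ident_pairs hXY hψm
    hc hψb hψ0 hv hvar
  convert hclt using 4 with n ω
  rw [← Finset.mul_sum, Finset.sum_sub_distrib]
  simp only [Finset.sum_const, Finset.card_range, nsmul_eq_mul, hE, hκ, hL, ha]
  ring

/-- A Lipschitz bound alone would lose the localization in `Y`, and with it a factor `h₁` in the
expectation. The tent `L₁` is at least `1` on `|u| ≤ R + 1`; beyond, both values of `K₁` vanish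
since `|s| ≤ 1`. -/
theorem KernelConditions.exists_lipschitz_envelope (hker : KernelConditions K₀ K₁) :
    ∃ (C : ℝ) (L₁ : ℝ → ℝ), 0 ≤ C ∧ Continuous L₁ ∧ HasCompactSupport L₁ ∧ (∀ u, 0 ≤ L₁ u) ∧
      ∀ u s, |s| ≤ 1 → |K₁ (u - s) - K₁ u| ≤ C * |s| * L₁ u := by
  obtain ⟨C, hC⟩ := hker.smooth_K₁.lipschitzWith_of_hasCompactSupport hker.compact_K₁ (by simp)
  obtain ⟨R, hR⟩ := exists_radius_of_hasCompactSupport hker.compact_K₁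
  refine ⟨C, fun u => max 0 (R + 2 - |u|), C.2, by fun_prop, ?_, fun u => le_max_left _ _,
    fun u s hs => ?_⟩
  · refine HasCompactSupport.intro (isCompact_closedBall 0 (R + 2)) fun u hu => ?_
    rw [mem_closedBall_zero_iff, not_le, Real.norm_eq_abs] at hu
    exact max_eq_left (by linarith)
  · by_cases hu : |u| ≤ R + 1
    · have h1 : |K₁ (u - s) - K₁ u| ≤ C * |s| := by
        have := hC.dist_le_mul (u - s) u
        simpa [Real.dist_eq] using this
      refine h1.trans (le_mul_of_one_le_right (by positivity) ?_)
      exact le_max_of_le_right (by linarith)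
    · have hzero : ∀ w, R < |w| → K₁ w = 0 := fun w hw => by
        by_contra hne
        exact absurd (hR w hne) (not_le.2 hw)
      have h2 : |u| ≤ |u - s| + |s| := by simpa using abs_add_le (u - s) s
      rw [hzero u (by linarith), hzero (u - s) (by linarith)]
      simp only [sub_self, abs_zero]
      positivity

/-- Replacing the regression function by its pilot estimator is asymptotically negligible. -/
theorem RegressionModel.tendstoInMeasure_plugin (hmodel : RegressionModel μ X Y ε m g f φ)
    (hreg : Regularity (μ.map (X 0)).support S₀ m g f φ) (hker : KernelConditions K₀ K₁)
    (hband : BandwidthConditions d b₀ h₀ h₁) (hx : x ∈ S₀) (e : ℝ) :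
    TendstoInMeasure μ (fun (n : ℕ) ω => (√((n : ℝ) * h₀ n ^ d * h₁ n))⁻¹ *
      ∑ i ∈ Finset.range n, K₀ ((h₀ n)⁻¹ • (X i ω - x)) *
        (K₁ ((Y i ω - nadarayaWatson K₀ (b₀ n) n (fun i => X i ω) (fun i => Y i ω) x - e) / h₁ n) -
          K₁ ((Y i ω - (m x + e)) / h₁ n))) atTop fun _ => 0 := by
  set N : ℕ → ℝ := fun n => (n : ℝ) * h₀ n ^ d * h₁ n with hN
  set δ : ℕ → Ω → ℝ := fun n ω =>
    nadarayaWatson K₀ (b₀ n) n (fun i => X i ω) (fun i => Y i ω) x - m x with hδ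
  have hU : TendstoInMeasure μ (fun n ω => √(N n) / h₁ n * δ n ω) atTop fun _ => 0 :=
    hmodel.tendstoInMeasure_pilot hreg hker hband hx
  obtain ⟨C, L₁, hC, hL₁c, hL₁s, hL₁0, hLip⟩ := hker.exists_lipschitz_envelope
  set L : Cov d × ℝ → ℝ := fun w => |K₀ w.1| * L₁ w.2 with hL
  have hLc : Continuous L :=
    (hker.continuous_K₀.abs.comp continuous_fst).mul (hL₁c.comp continuous_snd)
  have hLs : HasCompactSupport L :=
    hasCompactSupport_mul_prod (hker.hasCompactSupport.comp_left (g := fun t : ℝ => |t|) (by simp))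
      hL₁s
  obtain ⟨B, hB⟩ := hLs.exists_bound_of_continuous hLc
  have hXY : ∀ i, Measurable fun ω => (X i ω, Y i ω) := fun i =>
    (hmodel.measurable_X i).prodMk (hmodel.measurable_Y i)
  set κ : ℕ → Cov d × ℝ → ℝ :=
    fun n p => L ((h₀ n)⁻¹ • (p.1 - x), (p.2 - (m x + e)) / h₁ n) with hκ
  have hκm : ∀ n, Measurable (κ n) := fun n => hLc.measurable.comp (by fun_prop)
  have hκi : ∀ n, Integrable (fun ω => κ n (X 0 ω, Y 0 ω)) μ := fun n =>
    Integrable.of_bound ((hκm n).comp (hXY 0)).aestronglyMeasurable B (ae_of_all _ fun ω => hB _)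
  have hκ0 : ∀ n p, 0 ≤ κ n p := fun n p => mul_nonneg (abs_nonneg _) (hL₁0 _)
  have hφ := hreg.smooth_φ.continuous
  have hlim := tendsto_integral_rescale_prod (p := (x, m x + e)) hLc hLs hφ.measurable
    hφ.continuousAt hband.pos_h₀ hband.pos_h₁ hband.tendsto_h₀ hband.tendsto_h₁
  -- `T` is the normalized sum of the envelope kernel: nonnegative, with expectation converging to a
  -- finite limit.
  set T : ℕ → Ω → ℝ := fun n ω => (N n)⁻¹ * ∑ i ∈ Finset.range n, κ n (X i ω, Y i ω) with hT
  have hN0 : ∀ n, 0 ≤ N n := fun n => by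
    have := hband.pos_h₀ n
    have := hband.pos_h₁ n
    positivity
  have hT0 : ∀ n ω, 0 ≤ T n ω := fun n ω =>
    mul_nonneg (inv_nonneg.2 (hN0 n)) (Finset.sum_nonneg fun i _ => hκ0 n _)
  have hsum := fun n => integral_sum_eq hmodel.ident_pairs (hκm n) (hκi n) n
  have hTi : ∀ n, Integrable (T n) μ := fun n => (hsum n).1.const_mul _
  have hTC : ∀ᶠ n in atTop, ∫ ω, T n ω ∂μ ≤ (∫ w, L w) * φ (x, m x + e) + 1 := by
    filter_upwards [hlim.eventually_le_const (lt_add_one _), eventually_ge_atTop 1] with n hn hn1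
    have hn0 : (0 : ℝ) < n := by exact_mod_cast hn1
    have p0 := hband.pos_h₀ n
    have p1 := hband.pos_h₁ n
    refine le_of_eq_of_le ?_ hn
    simp only [hT]
    rw [integral_const_mul, (hsum n).2]
    simp only [hκ]
    rw [hmodel.integral_pair_kernel p0 p1 x (m x + e) hLc.measurable]
    simp only [hN]
    field_simp
  set W : ℕ → Ω → ℝ := fun n ω => (√(N n))⁻¹ * ∑ i ∈ Finset.range n,
    K₀ ((h₀ n)⁻¹ • (X i ω - x)) * (K₁ ((Y i ω - (m x + e)) / h₁ n - δ n ω / h₁ n) -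
      K₁ ((Y i ω - (m x + e)) / h₁ n)) with hW
  have hWeq : ∀ n ω, (√(N n))⁻¹ * ∑ i ∈ Finset.range n, K₀ ((h₀ n)⁻¹ • (X i ω - x)) *
        (K₁ ((Y i ω - nadarayaWatson K₀ (b₀ n) n (fun i => X i ω) (fun i => Y i ω) x - e) / h₁ n) -
          K₁ ((Y i ω - (m x + e)) / h₁ n)) = W n ω := fun n ω => by
    simp only [hW, hδ]
    congr 1
    refine Finset.sum_congr rfl fun i _ => ?_
    congr 3
    ring
  refine TendstoInMeasure.congr (f := W) (fun n => ae_of_all _ fun ω => (hWeq n ω).symm)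
    EventuallyEq.rfl ?_
  -- The envelope bound needs a shift of at most one, so it is applied on the event `|δ / h₁| ≤ 1`
  -- first; `hδ0` then shows that this event has probability tending to one.
  have hcut : TendstoInMeasure μ (fun n ω => if |δ n ω / h₁ n| ≤ 1 then W n ω else 0) atTop
      fun _ => 0 := by
    refine tendstoInMeasure_zero_of_abs_le_mul (U := fun n ω => C * (√(N n) / h₁ n * δ n ω)) ?_
      hT0 hTi hTC fun n ω => ?_
    · have hmul : ContinuousAt (fun t : ℝ => C * t) 0 := by fun_prop
      simpa using tendstoInMeasure_continuousAt_comp hmul hU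
    · split_ifs with hle
      · have p1 := hband.pos_h₁ n
        have e1 : |C * (√(N n) / h₁ n * δ n ω)| = √(N n) * (C * |δ n ω / h₁ n|) := by
          rw [abs_mul, abs_mul, abs_div, abs_div, abs_of_nonneg hC,
            abs_of_nonneg (Real.sqrt_nonneg _)]
          ring
        have e2 : (√(N n))⁻¹ = √(N n) * (N n)⁻¹ := by
          rw [← div_eq_mul_inv, Real.sqrt_div_self]
        simp only [hW]
        rw [abs_mul, abs_of_nonneg (inv_nonneg.2 (Real.sqrt_nonneg _)), e1, e2, mul_assoc,
          mul_assoc]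
        refine mul_le_mul_of_nonneg_left ?_ (Real.sqrt_nonneg _)
        simp only [hT]
        rw [mul_left_comm]
        refine mul_le_mul_of_nonneg_left ?_ (inv_nonneg.2 (hN0 n))
        rw [Finset.mul_sum]
        refine (Finset.abs_sum_le_sum_abs _ _).trans (Finset.sum_le_sum fun i _ => ?_)
        rw [abs_mul]
        simp only [hκ, hL]
        rw [mul_left_comm]
        gcongr
        exact hLip _ _ hle
      · rw [abs_zero]
        exact mul_nonneg (abs_nonneg _) (hT0 n ω)
  -- Since `√N → ∞`, the shift `δ / h₁` is eventually dominated by the scaled error `√N δ / h₁`.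
  have hδ0 : TendstoInMeasure μ (fun n ω => δ n ω / h₁ n) atTop fun _ => 0 := by
    have hsq : ∀ᶠ n in atTop, 1 ≤ √(N n) :=
      (Real.tendsto_sqrt_atTop.comp hband.large_h₀_h₁).eventually_ge_atTop 1
    rw [tendstoInMeasure_iff_norm] at hU ⊢
    intro η hη
    refine tendsto_of_tendsto_of_tendsto_of_le_of_le' tendsto_const_nhds (hU η hη)
      (Eventually.of_forall fun n => zero_le) ?_
    filter_upwards [hsq] with n hn
    refine measure_mono fun ω hω => ?_
    simp only [Set.mem_ofPred_eq, sub_zero] at *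
    refine hω.trans ?_
    rw [div_mul_eq_mul_div, mul_div_assoc, norm_mul]
    exact le_mul_of_one_le_left (norm_nonneg _) (hn.trans (le_abs_self _))
  refine tendstoInMeasure_of_eq_on_event (Metric.closedBall_mem_nhds (0 : ℝ) one_pos) hδ0 hcut
    (Eventually.of_forall fun n ω hω => ?_)
  rw [mem_closedBall_zero_iff, Real.norm_eq_abs] at hω
  rw [if_pos hω]

end Asymptotics

/-! ### Assembling the limit law -/

section AsymptoticNormality

variable {Ω : Type*} [MeasurableSpace Ω] {μ : Measure Ω} [IsProbabilityMeasure μ] {d : ℕ}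
  {X : ℕ → Ω → Cov d} {Y ε : ℕ → Ω → ℝ} {m g : Cov d → ℝ} {f : ℝ → ℝ} {φ : Cov d × ℝ → ℝ}
  {S₀ : Set (Cov d)} {K₀ : Cov d → ℝ} {K₁ : ℝ → ℝ} {b₀ h₀ h₁ : ℕ → ℝ} {x : Cov d}

theorem integral_sq_mul_prod (K₀ : Cov d → ℝ) (K₁ : ℝ → ℝ) :
    ∫ w : Cov d × ℝ, (K₀ w.1 * K₁ w.2) ^ 2 = ∫ z, ∫ v, K₀ z ^ 2 * K₁ v ^ 2 := by
  simp only [mul_pow, integral_const_mul, integral_mul_const]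
  exact integral_prod_mul (fun z => K₀ z ^ 2) fun v => K₁ v ^ 2

/-- The map `(id z + 0) * γ⁻¹` is the form in which the Slutsky step delivers the limit: the
Gaussian, plus the negligible terms, divided by the limiting denominator. -/
theorem gaussianReal_map_numerator_div {v γ c : ℝ} (hγ : 0 < γ) (hc : v / γ ^ 2 = c) :
    (gaussianReal 0 v.toNNReal).map (fun z => (id z + 0) * γ⁻¹) =
      (gaussianReal 0 c.toNNReal).map id := by
  simp only [id_eq, add_zero, Measure.map_id]
  rw [gaussianReal_map_mul_const, mul_zero]
  congr 1
  ext
  subst hc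
  rw [div_eq_mul_inv, mul_comm v, Real.toNNReal_mul (by positivity)]
  simp only [NNReal.coe_mul, NNReal.coe_mk, Real.coe_toNNReal', inv_pow]
  rw [max_eq_left (by positivity : 0 ≤ (γ ^ 2)⁻¹)]

/-- The error of the kernel estimator of the density of the covariate is negligible at the scale
of the naive estimator. -/
theorem RegressionModel.tendstoInMeasure_scaled_density
    (hmodel : RegressionModel μ X Y ε m g f φ) {S : Set (Cov d)} (hreg : Regularity S S₀ m g f φ)
    (hker : KernelConditions K₀ K₁) (hd : 1 ≤ d) (hband : BandwidthConditions d b₀ h₀ h₁)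
    (hx : x ∈ S₀) {c : ℕ → ℝ} {c' : ℝ} (hc : Tendsto c atTop (𝓝 c')) :
    TendstoInMeasure μ (fun (n : ℕ) ω => c n * √((n : ℝ) * h₀ n ^ d * h₁ n) *
      (1 / ((n : ℝ) * h₀ n ^ d) * ∑ i ∈ Finset.range n, K₀ ((h₀ n)⁻¹ • (X i ω - x)) - g x))
      atTop fun _ => 0 := by
  obtain ⟨hint, C, -, hC⟩ :=
    hmodel.exists_density_mse_le hreg hker hx hband.pos_h₀ hband.tendsto_h₀
  refine tendstoInMeasure_of_tendsto_integral_sq (fun n => ?_) ?_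
  · simp only [sub_zero, mul_pow (c n * _)]
    exact (hint n).const_mul _
  · simp only [sub_zero, mul_pow (c _ * _), integral_const_mul]
    refine squeeze_zero' (Eventually.of_forall fun n => ?_) (g := fun n : ℕ => c n ^ 2 * (C *
      ((n : ℝ) * h₀ n ^ d * h₁ n * (h₀ n ^ 4 + 1 / ((n : ℝ) * h₀ n ^ d))))) ?_ ?_
    · exact mul_nonneg (sq_nonneg _) (integral_nonneg fun ω => sq_nonneg _)
    · filter_upwards [hC] with n hn
      have := hband.pos_h₀ n
      have := hband.pos_h₁ n
      rw [mul_pow, Real.sq_sqrt (by positivity), mul_assoc, mul_left_comm C]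
      gcongr
    · simpa using (hc.pow 2).mul ((hband.tendsto_undersmoothing hd).const_mul C)

theorem measurable_nadarayaWatson (hK₀ : Measurable K₀) (hX : ∀ i, Measurable (X i))
    (hY : ∀ i, Measurable (Y i)) (b : ℝ) (n : ℕ) (x : Cov d) :
    Measurable fun ω => nadarayaWatson K₀ b n (fun i => X i ω) (fun i => Y i ω) x := by
  have hk : ∀ i, Measurable fun ω => K₀ (b⁻¹ • (X i ω - x)) := fun i =>
    hK₀.comp (((hX i).sub_const x).const_smul b⁻¹)
  exact (Finset.measurable_sum _ fun i _ => (hY i).mul (hk i)).div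
    (Finset.measurable_sum _ fun i _ => hk i)

theorem measurable_naiveEstimator (hK₀ : Measurable K₀) (hK₁ : Measurable K₁)
    (hX : ∀ i, Measurable (X i)) (hY : ∀ i, Measurable (Y i)) (b h k : ℝ) (n : ℕ) (e : ℝ)
    (x : Cov d) :
    Measurable fun ω => naiveEstimator K₀ K₁ b h k n (fun i => X i ω) (fun i => Y i ω) e x := by
  have hk : ∀ i, Measurable fun ω => K₀ (h⁻¹ • (X i ω - x)) := fun i =>
    hK₀.comp (((hX i).sub_const x).const_smul h⁻¹)
  have hm := measurable_nadarayaWatson hK₀ hX hY b n x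
  exact ((Finset.measurable_sum _ fun i _ => (hk i).mul
    (hK₁.comp ((((hY i).sub hm).sub_const e).div_const k))).const_mul _).div
    ((Finset.measurable_sum _ fun i _ => hk i).const_mul _)

/-- The decomposition of the normalized error: `A` is the sum with the true regression function, `S`
the one with the pilot, `G` the random denominator and `γ` its limit. -/
theorem sqrt_mul_ratio_sub_eq {N A S G a γ : ℝ} (hN : 0 < N) (hG : G ≠ 0) (hγ : γ ≠ 0) :
    ((√N)⁻¹ * (A - N * a) + ((√N)⁻¹ * (S - A) + -(a / γ * √N * (G - γ)))) * G⁻¹ =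
      √N * (1 / N * S / G - a / γ) := by
  have hs : 0 < √N := Real.sqrt_pos.2 hN
  have hs2 : N = √N ^ 2 := (Real.sq_sqrt hN.le).symm
  rw [hs2, Real.sqrt_sq hs.le]
  field_simp
  ring

/-- Asymptotic normality of the naive estimator around the smoothed ratio. -/
theorem RegressionModel.tendstoInDistribution_naiveEstimator
    (hmodel : RegressionModel μ X Y ε m g f φ)
    (hreg : Regularity (μ.map (X 0)).support S₀ m g f φ) (hker : KernelConditions K₀ K₁)
    (hd : 1 ≤ d) (hband : BandwidthConditions d b₀ h₀ h₁) (hx : x ∈ S₀) (e : ℝ) :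
    TendstoInDistribution
      (fun (n : ℕ) ω => √((n : ℝ) * h₀ n ^ d * h₁ n) *
        (naiveEstimator K₀ K₁ (b₀ n) (h₀ n) (h₁ n) n (fun i => X i ω) (fun i => Y i ω) e x
          - (∫ w : Cov d × ℝ, K₀ w.1 * K₁ w.2 *
            φ ((x, m x + e) + (h₀ n • w.1, h₁ n * w.2))) / g x))
      atTop (id : ℝ → ℝ) (fun _ => μ)
      (gaussianReal 0 (asympVar K₀ K₁ g f x e).toNNReal) := by
  have hg := hreg.pos_g x hx
  have hφ := hreg.smooth_φ.continuous
  have hK₀m := hker.continuous_K₀.measurable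
  have hK₁m := hker.smooth_K₁.continuous.measurable
  have hXm := hmodel.measurable_X
  have hYm := hmodel.measurable_Y
  set a : ℕ → ℝ := fun n => ∫ w : Cov d × ℝ, K₀ w.1 * K₁ w.2 *
    φ ((x, m x + e) + (h₀ n • w.1, h₁ n * w.2)) with ha
  have hLc : Continuous fun w : Cov d × ℝ => K₀ w.1 * K₁ w.2 :=
    (hker.continuous_K₀.comp continuous_fst).mul (hker.smooth_K₁.continuous.comp continuous_snd)
  have halim := tendsto_integral_rescale_prod (p := (x, m x + e)) hLc
    (hasCompactSupport_mul_prod hker.hasCompactSupport hker.compact_K₁) hφ.measurable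
    hφ.continuousAt hband.pos_h₀ hband.pos_h₁ hband.tendsto_h₀ hband.tendsto_h₁
  have hW := hmodel.tendstoInDistribution_numerator hker hband x (m x + e) hφ
  have hr := hmodel.tendstoInMeasure_plugin hreg hker hband hx e
  have hB := hmodel.tendstoInMeasure_scaled_density hreg hker hd hband hx
    (halim.div_const (g x))
  have hG := hmodel.tendstoInMeasure_density hreg hker hx hband.pos_h₀ hband.tendsto_h₀
    (hband.tendsto_density_mse hd)
  set G : ℕ → Ω → ℝ := fun n ω => 1 / ((n : ℝ) * h₀ n ^ d) * ∑ i ∈ Finset.range n,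
    K₀ ((h₀ n)⁻¹ • (X i ω - x)) with hGdef
  have hinv : TendstoInMeasure μ (fun n ω => (G n ω)⁻¹) atTop fun _ => (g x)⁻¹ :=
    tendstoInMeasure_continuousAt_comp (continuousAt_inv₀ hg.ne') hG
  have hsub : ContinuousAt (fun p : ℝ × ℝ => p.1 + -p.2) (0, 0) := by fun_prop
  have hrB := tendstoInMeasure_continuousAt_comp hsub (tendstoInMeasure_prodMk hr hB)
  simp only [neg_zero, add_zero] at hrB
  have hk : ∀ n i, Measurable fun ω => K₀ ((h₀ n)⁻¹ • (X i ω - x)) := fun n i =>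
    hK₀m.comp (((hXm i).sub_const x).const_smul (h₀ n)⁻¹)
  have hGm : ∀ n, Measurable (G n) := fun n =>
    (Finset.measurable_sum _ fun i _ => hk n i).const_mul _
  have hmm := fun n => measurable_nadarayaWatson hK₀m hXm hYm (b₀ n) n x
  -- Slutsky's lemma: the first coordinate is the Gaussian part, the second the negligible terms,
  -- the third the inverse denominator.
  have hlim := hW.continuous_comp_prodMk_of_tendstoInMeasure_const
    (g := fun q : ℝ × (ℝ × ℝ) => (q.1 + q.2.1) * q.2.2) (by fun_prop)
    (tendstoInMeasure_prodMk hrB hinv) fun n => by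
      refine Measurable.aemeasurable (Measurable.prodMk (Measurable.add ?_ (Measurable.neg ?_))
        (hGm n).inv)
      · refine (Finset.measurable_sum _ fun i _ => (hk n i).mul (Measurable.sub ?_ ?_)).const_mul _
        · exact hK₁m.comp ((((hYm i).sub (hmm n)).sub_const e).div_const _)
        · exact hK₁m.comp (((hYm i).sub_const _).div_const _)
      · exact ((hGm n).sub_const _).const_mul _
  have hvar : (∫ w : Cov d × ℝ, (K₀ w.1 * K₁ w.2) ^ 2) * φ (x, m x + e) / g x ^ 2 =
      asympVar K₀ K₁ g f x e := by
    rw [integral_sq_mul_prod, hmodel.joint_density_eq hreg hx, asympVar]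
    field_simp
  refine tendstoInDistribution_of_tendstoInMeasure_sub _ _
    (tendstoInDistribution_of_map_eq hlim aemeasurable_id
      (gaussianReal_map_numerator_div hg hvar)) ?_ fun n =>
    (((measurable_naiveEstimator hK₀m hK₁m hXm hYm _ _ _ n e x).sub_const _).const_mul
      _).aemeasurable
  have hzero : TendstoInMeasure μ (fun (_ : ℕ) (_ : Ω) => (0 : ℝ)) atTop fun _ => 0 := by
    rw [tendstoInMeasure_const_iff]
    intro s hs
    simp [mem_of_mem_nhds hs]
  -- The decomposition is an exact identity where `G ≠ 0`, so the difference of the two sequences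
  -- vanishes on an event of probability tending to one.
  refine tendstoInMeasure_of_eq_on_event (isOpen_ne.mem_nhds hg.ne') hG hzero ?_
  filter_upwards [eventually_ge_atTop 1] with n hn ω hω
  have hn0 : (0 : ℝ) < n := by exact_mod_cast hn
  have p0 := hband.pos_h₀ n
  have p1 := hband.pos_h₁ n
  have key := sqrt_mul_ratio_sub_eq (N := (n : ℝ) * h₀ n ^ d * h₁ n) (G := G n ω)
    (A := ∑ i ∈ Finset.range n, K₀ ((h₀ n)⁻¹ • (X i ω - x)) * K₁ ((Y i ω - (m x + e)) / h₁ n))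
    (S := ∑ i ∈ Finset.range n, K₀ ((h₀ n)⁻¹ • (X i ω - x)) *
      K₁ ((Y i ω - nadarayaWatson K₀ (b₀ n) n (fun i => X i ω) (fun i => Y i ω) x - e) / h₁ n))
    (a := a n) (by positivity) hω hg.ne'
  rw [← Finset.sum_sub_distrib] at key
  simp only [← mul_sub] at key
  rw [Pi.sub_apply, Pi.sub_apply, eq_comm, sub_eq_zero]
  exact key.symm

end AsymptoticNormality

/-! ### Conclusion -/

theorem amse_eq_meanSquareProfile {d : ℕ} (K₀ : Cov d → ℝ) (K₁ : ℝ → ℝ)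
    (m g : Cov d → ℝ) (f : ℝ → ℝ) (φ : Cov d × ℝ → ℝ) (x : Cov d) (e : ℝ) (n : ℕ) (s t : ℝ) :
    amse K₀ K₁ m g f φ x e n s t = meanSquareProfile d (mu1 K₀ m φ x e / (2 * g x))
      (mu2 K₁ m φ x e / (2 * g x)) (f e * (∫ z, K₀ z ^ 2) * (∫ v, K₁ v ^ 2) / g x) n s t := by
  rw [amse, leadingBias, meanSquareProfile, div_div, mul_comm (g x)]
  ring

end NaiveResidualDensity

open NaiveResidualDensity in
theorem proposition3p1 {Ω : Type*} [MeasurableSpace Ω] (μ : Measure Ω) [IsProbabilityMeasure μ]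
    (d : ℕ) (hd : 1 ≤ d)
    (X : ℕ → Ω → Cov d) (Y ε : ℕ → Ω → ℝ) (m g : Cov d → ℝ) (f : ℝ → ℝ) (φ : Cov d × ℝ → ℝ)
    (S₀ : Set (Cov d)) (K₀ : Cov d → ℝ) (K₁ : ℝ → ℝ) (b₀ h₀ h₁ : ℕ → ℝ)
    (hmodel : RegressionModel μ X Y ε m g f φ)
    (hreg : Regularity (μ.map (X 0)).support S₀ m g f φ)
    (hker : KernelConditions K₀ K₁)
    (hband : BandwidthConditions d b₀ h₀ h₁)
    (x : Cov d) (hx : x ∈ S₀) (e : ℝ) :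
    -- asymptotic normality around a deterministic centering with the stated expansion
    (∃ fbar : ℕ → ℝ,
      ((fun n => fbar n - (f e + leadingBias K₀ K₁ m g φ x e (h₀ n) (h₁ n)))
        =o[atTop] fun n => h₀ n ^ 2 + h₁ n ^ 2) ∧
      TendstoInDistribution
        (fun (n : ℕ) ω => √((n : ℝ) * h₀ n ^ d * h₁ n) *
          (naiveEstimator K₀ K₁ (b₀ n) (h₀ n) (h₁ n) n (fun i => X i ω) (fun i => Y i ω) e x
            - fbar n))
        atTop (id : ℝ → ℝ) (fun _ => μ)
        (gaussianReal 0 (asympVar K₀ K₁ g f x e).toNNReal)) ∧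
    -- the optimal bandwidths and the resulting rate
    (0 < f e → 0 < mu1 K₀ m φ x e * mu2 K₁ m φ x e →
      ∃ c₀ > (0 : ℝ), ∃ c₁ > (0 : ℝ), ∃ C > (0 : ℝ), ∀ n : ℕ, 1 ≤ n →
        (∀ s₀ > (0 : ℝ), ∀ s₁ > (0 : ℝ),
          (∀ t₀ > (0 : ℝ), ∀ t₁ > (0 : ℝ),
              amse K₀ K₁ m g f φ x e n s₀ s₁ ≤ amse K₀ K₁ m g f φ x e n t₀ t₁) ↔
            s₀ = c₀ * (n : ℝ) ^ (-(1 : ℝ) / (d + 5)) ∧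
            s₁ = c₁ * (n : ℝ) ^ (-(1 : ℝ) / (d + 5))) ∧
        √(amse K₀ K₁ m g f φ x e n (c₀ * (n : ℝ) ^ (-(1 : ℝ) / (d + 5)))
            (c₁ * (n : ℝ) ^ (-(1 : ℝ) / (d + 5)))) = C * (n : ℝ) ^ (-(2 : ℝ) / (d + 5))) := by
  have hg := hreg.pos_g x hx
  -- The centering left open is fixed by unification as the smoothed joint density divided by `g x`.
  refine ⟨⟨_, ?_, hmodel.tendstoInDistribution_naiveEstimator hreg hker hd hband hx e⟩,
    fun hf hmu => ?_⟩
  · have h := (hker.smoothed_density_expansion hreg.smooth_φ m x e hband.pos_h₀ hband.pos_h₁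
      hband.tendsto_h₀ hband.tendsto_h₁).const_mul_left (g x)⁻¹
    refine h.congr_left fun n => ?_
    rw [hmodel.joint_density_eq hreg hx, leadingBias]
    field_simp
    ring
  · simp only [amse_eq_meanSquareProfile]
    refine exists_optimal_bandwidths hd ?_ ?_
    · rw [div_mul_div_comm]
      positivity
    · have := hker.integral_sq_pos
      have := hker.integral_sq_pos_snd
      positivity
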